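/- Let $U\subset\mathbb{C}$ be a simply connected domain. Let $M_1,\dots,M_r$ be pairwise disjoint open subsets of $U$ such that $U\setminus\bigcup_i M_i$ has Lebesgue measure $0$, let $A_1,\dots,A_r$ be pairwise distinct analytic functions in $U$, and let $\Phi$ be a (piecewise analytic) function with $$\Phi=\sum_{i=1}^r A_i\chi_{M_i}\quad\text{a.e. in }U,$$ where $\chi_{M_i}$ is the characteristic function of $M_i$. Assume that $\partial\Phi/\partial\bar z\ge 0$ in the sense of distributions on $U$, i.e. the distribution $\partial\Phi/\partial\bar z$ takes nonnegative real values on nonnegative test functions. Let $p\in U$ satisfy (i) $p\in\overline{M_i}$ for $1\le i\le r$; (ii) $A_i(p)-A_k(p)\notin\mathbb{R}\,(A_j(p)-A_k(p))$ for every triple of distinct indices $i,j,k\in\{1,\dots,r\}$; (iii) $A_i(p)\ne A_k(p)$ for every pair of distinct indices $i,k\in\{1,\dots,r\}$. Put $H_i(z)=\operatorname{Re}\int_p^z A_i(w)\,dw$ for $z\in U$ (the integral being taken along any $C^1$ path from $p$ to $z$ in $U$), and $\varphi(z)=\max_{1\le i\le r}H_i(z)$. Then there is an open neighborhood $N\subset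 U$ of $p$ such that $$\Phi=2\,\frac{\partial\varphi}{\partial z}\quad\text{a.e. in }N.$$ Here the derivative may be read in either sense: $\Phi$ and $2\,\partial\varphi/\partial z$ are equal as distributions on $N$, and for almost every $z\in N$ the function $\varphi$ is real differentiable at $z$ with $\Phi(z)=2\,\frac{\partial\varphi}{\partial z}(z)$, where $\frac{\partial}{\partial z}=\frac12\left(\frac{\partial}{\partial x}-i\frac{\partial}{\partial y}\right)$. -/

import Mathlib

open MeasureTheory TopologicalSpace
open scoped Distributions LineDeriv ComplexOrder

noncomputable section

namespace PiecewiseAnalytic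

/-- The distribution on `Ω` defined by a locally integrable function `f`, that is
`ψ ↦ ∫ ψ f`, the integral being with respect to Lebesgue measure. (It is the zero distribution
when `f` is not locally integrable on `Ω`.) -/
def toDistribution (Ω : Opens ℂ) (f : ℂ → ℂ) : 𝓓'(Ω, ℂ) :=
  TestFunction.integralAgainstBilinCLM (𝕜 := ℝ)
    (ContinuousLinearMap.lsmul ℝ ℝ : ℝ →L[ℝ] ℂ →L[ℝ] ℂ) volume f

/-- The distributional derivative `∂/∂z = (∂/∂x - i ∂/∂y) / 2`. -/
def distDz {Ω : Opens ℂ} (T : 𝓓'(Ω, ℂ)) : 𝓓'(Ω, ℂ) :=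
  (1 / 2 : ℂ) • (∂_{(1 : ℂ)} T - Complex.I • ∂_{Complex.I} T)

/-- The distributional derivative `∂/∂z̄ = (∂/∂x + i ∂/∂y) / 2`. -/
def distDzbar {Ω : Opens ℂ} (T : 𝓓'(Ω, ℂ)) : 𝓓'(Ω, ℂ) :=
  (1 / 2 : ℂ) • (∂_{(1 : ℂ)} T + Complex.I • ∂_{Complex.I} T)

/-- A complex distribution is nonnegative if it takes nonnegative real values on nonnegative
test functions (`0 ≤ w` for a complex number means that `w` is real and nonnegative). -/
def IsNonneg {Ω : Opens ℂ} (T : 𝓓'(Ω, ℂ)) : Prop :=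
  ∀ ψ : 𝓓(Ω, ℝ), (∀ z, 0 ≤ ψ z) → 0 ≤ T ψ

/-- `Σ(Ω)`: the distributions on `Ω` whose derivative with respect to `z̄` is nonnegative. -/
def Sigma (Ω : Opens ℂ) : Set 𝓓'(Ω, ℂ) :=
  {T | IsNonneg (distDzbar T)}

/-- The pointwise derivative `∂/∂z = (∂/∂x - i ∂/∂y) / 2` of a real-valued function
(meaningful at points where it is real differentiable). -/
def dz (u : ℂ → ℝ) (z : ℂ) : ℂ :=
  (1 / 2 : ℂ) * ((fderiv ℝ u z 1 : ℂ) - Complex.I * (fderiv ℝ u z Complex.I : ℂ))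

/-- `Φ` is piecewise analytic in `U`, with pieces `M i` and analytic functions `A i`:
`Φ = ∑ i, A i · χ_{M i}` a.e. in `U`. -/
structure IsPiecewiseAnalytic (U : Opens ℂ) {r : ℕ} (M : Fin r → Set ℂ) (A : Fin r → ℂ → ℂ)
    (Φ : ℂ → ℂ) : Prop where
  isOpen : ∀ i, IsOpen (M i)
  subset : ∀ i, M i ⊆ U
  disjoint : Pairwise fun i j => Disjoint (M i) (M j)
  null_compl : volume ((U : Set ℂ) \ ⋃ i, M i) = 0
  analytic : ∀ i, AnalyticOnNhd ℂ (A i) U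
  distinct : Pairwise fun i j => ∃ z ∈ U, A i z ≠ A j z
  ae_eq : ∀ᵐ z ∂volume.restrict (U : Set ℂ), Φ z = ∑ i, (M i).indicator (A i) z

/-- `γ` is a continuously differentiable path that stays in `U`. -/
def IsC1PathIn (U : Opens ℂ) {a b : ℂ} (γ : Path a b) : Prop :=
  (∀ t, γ t ∈ U) ∧ ContDiffOn ℝ 1 γ.extend (Set.Icc 0 1)

/-- The complex line integral `∫_γ f(w) dw`. -/
def lineIntegral (f : ℂ → ℂ) {a b : ℂ} (γ : Path a b) : ℂ :=
  curveIntegral (fun w => ContinuousLinearMap.toSpanSingleton ℂ (f w)) γ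

open Classical in
/-- `Re ∫_p^z f(w) dw`, the integral being taken along some `C¹` path from `p` to `z` in `U`.
For `f` analytic in a simply connected domain `U` and `p, z ∈ U` such a path exists
and the value does not depend on its choice. (Value `0` when there is no such path.) -/
def rePrimitive (U : Opens ℂ) (p : ℂ) (f : ℂ → ℂ) (z : ℂ) : ℝ :=
  if h : ∃ γ : Path p z, IsC1PathIn U γ then (lineIntegral f h.choose).re else 0

/-- The function `φ(z) = max_i H_i(z)`, where `H_i(z) = Re ∫_p^z A_i(w) dw`. -/
def maxPrimitive (U : Opens ℂ) (p : ℂ) {r : ℕ} (A : Fin r → ℂ → ℂ) (z : ℂ) : ℝ :=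
  ⨆ i, rePrimitive U p (A i) z

end PiecewiseAnalytic

end

/-!
The function `Φ` has a real potential near `p`: since `∂Φ/∂z̄` is real, the mollifications of the
form `Re (Φ dz)` are closed, and a limit of their primitives is a Lipschitz function `u` with
`u p = 0` and `du = Re (Φ dz)` almost everywhere, that is `Φ = 2 ∂u/∂z` (`exists_isPotential`).
On `M k` the function `u` differs from `H k = Re (F k)` by locally constant functions, where `F k`
is the primitive of `A k` vanishing at `p`, and `u` is subharmonic because `∂Φ/∂z̄ ≥ 0`. The theorem
follows once `u = max H k` near `p` (`IsPotential.eventually_eq_max`).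

To see this, consider an index `i` and a cone of directions along which no `H k - H i` increases.
From a point `x` of `M i` on, `v = u - H i` does not increase along the directions of the cone, but
`v` is constant near `x` and subharmonic, so by the strong maximum principle `v` is constant on the
part of the translated cone that lies near `p`. The index `i` is active at `p`, so `x` may tend to
`p`, and `u = H i` on the cone with vertex `p` (`IsPotential.eventually_eq_re_of_cone`).

Such cones fill a neighbourhood of `p`. Fix a direction `d`. If a single index `i` maximizes
`Re (A i p * d)`, all directions close to `d` are admissible for `i`. Otherwise exactly two indices
`i`, `j` do, because three of the values `A k p` are never collinear. In this case the cone is taken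
in the chart `F i - F j`, in which `H i - H j` is the real part: the admissible directions for `i` are
those close to the image of `d` in the half-plane of nonnegative real part, so that the curved
sector on which `H j ≤ H i` is covered exactly (`IsPotential.eventually_sectorFilter_of_max`).
Compactness of the circle of directions concludes.

Two auxiliary facts are proved along the way: holomorphic functions on simply connected domains have
primitives (`exists_primitive`), which identifies `rePrimitive` with `Re (F i)`, and a strong
maximum principle for continuous functions that are subharmonic in the sense of distributions, by
testing against the barrier of Hopf's lemma (`IsWeaklySubharmonicOn.eqOn_of_isPreconnected`).
-/

namespace PiecewiseAnalytic

open Metric Set Filter Topology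
open scoped Convolution ContDiff NNReal

/-! ### Primitives on simply connected domains -/

/-- A locally constant cocycle on a simply connected space is a coboundary: it is the transition
cocycle of a covering space, and the identity map lifts to a global section of that covering. -/
theorem exists_trivialization_of_locallyConstant_cocycle {X G : Type*} [TopologicalSpace X]
    [SimplyConnectedSpace X] [LocallyPathConnectedSpace X] [AddCommGroup G]
    (B : X → Set X) (hBo : ∀ x, IsOpen (B x)) (hB : ∀ x, x ∈ B x) (c : X → X → X → G)
    (hc_self : ∀ i, ∀ y ∈ B i, c i i y = 0)
    (hc_const : ∀ i j, ∀ y ∈ B i ∩ B j, ∀ᶠ y' in 𝓝 y, c i j y' = c i j y)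
    (hc_comp : ∀ i j k, ∀ y ∈ B i ∩ B j ∩ B k, c i j y + c j k y = c i k y) :
    ∃ a : X → X → G, (∀ i, ∀ y ∈ B i, ∀ᶠ y' in 𝓝 y, a i y' = a i y) ∧
      ∀ i j, ∀ y ∈ B i ∩ B j, a j y = a i y + c i j y := by
  -- With a discrete fibre, the bundle glued along `c` is a covering space.
  let : TopologicalSpace G := ⊥
  have : DiscreteTopology G := ⟨rfl⟩
  let Z : FiberBundleCore X X G :=
    { baseSet := B
      isOpen_baseSet := hBo
      indexAt := id
      mem_baseSet_at := hB
      coordChange := fun i j y v => v + c i j y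
      coordChange_self := fun i y hy v => by simp [hc_self i y hy]
      continuousOn_coordChange := by
        rintro i j ⟨y, v⟩ ⟨hy, -⟩
        refine ContinuousAt.continuousWithinAt ?_
        refine continuousAt_snd.add ?_
        have h1 : ContinuousAt (c i j) y :=
          continuousAt_const.congr ((hc_const i j y hy).mono fun _ h => h.symm)
        exact ContinuousAt.comp (f := Prod.fst) (x := (y, v)) h1 continuousAt_fst
      coordChange_comp := fun i j k y hy v => by
        rw [add_assoc, hc_comp i j k y hy] }
  have hcov : IsCoveringMap (Bundle.TotalSpace.proj : Z.TotalSpace → X) :=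
    FiberBundle.isCoveringMap
  obtain ⟨x₀⟩ : Nonempty X := inferInstance
  obtain ⟨s, ⟨-, hs⟩, -⟩ := hcov.existsUnique_continuousMap_lifts
    (ContinuousMap.id X) (a₀ := x₀) (e₀ := (⟨x₀, (0 : G)⟩ : Z.TotalSpace)) rfl
  have hs' : ∀ y, (s y).proj = y := fun y => congr_fun hs y
  refine ⟨fun i y => (Z.localTriv i (s y)).2, fun i y hy => ?_, fun i j y hy => ?_⟩
  · have hsrc : s y ∈ (Z.localTriv i).source := by
      rw [Z.mem_localTriv_source, ← Z.baseSet_at, hs']; exact hy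
    have h1 : ContinuousAt (fun y => (Z.localTriv i (s y)).2) y :=
      continuous_snd.continuousAt.comp
        (((Z.localTriv i).continuousAt hsrc).comp s.continuous.continuousAt)
    exact h1.eventually (eventually_nhds_iff.2
      ⟨{(Z.localTriv i (s y)).2}, fun _ h => h, isOpen_discrete _, rfl⟩)
  · have h := Z.coordChange_comp ((s y).proj) i j y
      ⟨⟨by rw [hs']; exact hB y, hy.1⟩, hy.2⟩ (s y).2
    simp only [Z.localTriv_apply, hs'] at h ⊢
    exact h.symm

/-- A holomorphic function on a simply connected open set has a primitive. Local primitives on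
balls differ by locally constant functions, and this cocycle is a coboundary. -/
theorem exists_primitive {U : Set ℂ} (hUo : IsOpen U) (hU : IsSimplyConnected U) {f : ℂ → ℂ}
    (hf : DifferentiableOn ℂ f U) : ∃ F : ℂ → ℂ, ∀ z ∈ U, HasDerivAt F (f z) z := by
  have := hU.simplyConnectedSpace
  have := hUo.locallyPathConnectedSpace
  have hball : ∀ x : U, ∃ r > 0, ball (x : ℂ) r ⊆ U := fun x =>
    Metric.isOpen_iff.1 hUo x x.2
  choose r hr hrU using hball
  have hprim : ∀ x : U, ∃ g : ℂ → ℂ, ∀ z ∈ ball (x : ℂ) (r x), HasDerivAt g (f z) z := fun x =>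
    (hf.mono (hrU x)).isExactOn_ball
  choose g hg using hprim
  obtain ⟨a, ha, hac⟩ := exists_trivialization_of_locallyConstant_cocycle
    (X := U) (G := ℂ) (fun x => {y | (y : ℂ) ∈ ball (x : ℂ) (r x)})
    (fun x => isOpen_ball.preimage continuous_subtype_val) (fun x => mem_ball_self (hr x))
    (fun i j y => g i y - g j y) (fun i y _ => sub_self _)
    (fun i j y hy => by
      have ho : IsOpen (ball (i : ℂ) (r i) ∩ ball (j : ℂ) (r j)) := isOpen_ball.inter isOpen_ball
      obtain ⟨ε, hε, hsub⟩ := Metric.isOpen_iff.1 ho y hy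
      have hconst : ∀ w ∈ ball (y : ℂ) ε, g i w - g j w = g i y - g j y := fun w hw => by
        have hd : ∀ v ∈ ball (y : ℂ) ε, HasDerivAt (fun w => g i w - g j w) 0 v := fun v hv => by
          have h := (hg i v (hsub hv).1).sub (hg j v (hsub hv).2)
          rw [sub_self] at h
          exact h
        exact (convex_ball (y : ℂ) ε).is_const_of_fderivWithin_eq_zero (𝕜 := ℂ)
          (fun v hv => (hd v hv).differentiableAt.differentiableWithinAt)
          (fun v hv => by
            rw [fderivWithin_of_isOpen isOpen_ball hv, (hd v hv).hasFDerivAt.fderiv]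
            ext; simp) hw (mem_ball_self hε)
      exact (continuous_subtype_val.continuousAt.eventually (ball_mem_nhds (y : ℂ) hε)).mono
        fun w hw => hconst w hw)
    (fun i j k y _ => by ring)
  classical
  refine ⟨fun z => if h : z ∈ U then g ⟨z, h⟩ z + a ⟨z, h⟩ ⟨z, h⟩ else 0, fun z hz => ?_⟩
  have hd : HasDerivAt (fun w => g ⟨z, hz⟩ w + a ⟨z, hz⟩ ⟨z, hz⟩) (f z) z :=
    (hg ⟨z, hz⟩ z (mem_ball_self (hr _))).add_const _
  refine hd.congr_of_eventuallyEq ?_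
  have h1 : ∀ᶠ w in 𝓝 z, ∀ h : w ∈ U, a ⟨z, hz⟩ ⟨w, h⟩ = a ⟨z, hz⟩ ⟨z, hz⟩ := by
    have := ha ⟨z, hz⟩ ⟨z, hz⟩ (mem_ball_self (hr _))
    rw [nhds_subtype_eq_comap, eventually_comap] at this
    exact this.mono fun w hw h => hw ⟨w, h⟩ rfl
  filter_upwards [h1, hUo.mem_nhds hz, ball_mem_nhds z (hr ⟨z, hz⟩)] with w hw hwU hwb
  have h2 := hac ⟨z, hz⟩ ⟨w, hwU⟩ ⟨w, hwU⟩ ⟨hwb, mem_ball_self (hr _)⟩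
  simp only [hwU, dif_pos, h2, hw hwU]
  ring

/-- The fundamental theorem of calculus for line integrals along `C¹` paths. -/
theorem lineIntegral_eq_sub {U : Opens ℂ} {f F : ℂ → ℂ} (hf : ContinuousOn f U)
    (hF : ∀ z ∈ U, HasDerivAt F (f z) z) {a b : ℂ} {γ : Path a b} (hγ : IsC1PathIn U γ) :
    lineIntegral f γ = F b - F a := by
  have hγU : ∀ t, γ.extend t ∈ U := fun t => hγ.1 _
  have hcurve : CurveIntegrable (fun w => ContinuousLinearMap.toSpanSingleton ℂ (f w)) γ := by
    refine ContinuousOn.curveIntegrable_of_contDiffOn (s := U) ?_ hγ.2 hγ.1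
    exact (ContinuousLinearMap.toSpanSingletonCLE (𝕜 := ℂ) (E := ℂ)).continuous.comp_continuousOn hf
  rw [lineIntegral, curveIntegral_def]
  have := intervalIntegral.integral_eq_sub_of_hasDeriv_right (a := 0) (b := 1)
    (f := fun t => F (γ.extend t))
    (f' := curveIntegralFun (fun w => ContinuousLinearMap.toSpanSingleton ℂ (f w)) γ)
    (fun t _ => ((hF _ (hγU t)).continuousAt.comp γ.continuous_extend.continuousAt).continuousWithinAt)
    (fun t ht => ?_) hcurve
  · simpa using this
  · rw [min_eq_left zero_le_one, max_eq_right zero_le_one] at ht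
    have hnhds : Icc (0 : ℝ) 1 ∈ 𝓝 t := Icc_mem_nhds ht.1 ht.2
    have hd : HasDerivAt γ.extend (derivWithin γ.extend (Icc 0 1) t) t := by
      rw [derivWithin_of_mem_nhds hnhds]
      exact ((hγ.2.contDiffAt hnhds).differentiableAt (by simp)).hasDerivAt
    rw [curveIntegralFun_def]
    have h := ((hF _ (hγU t)).hasFDerivAt.restrictScalars ℝ).comp_hasDerivAt t hd
    exact h.hasDerivWithinAt

theorem rePrimitive_eq {U : Opens ℂ} {f F : ℂ → ℂ} (hf : ContinuousOn f U)
    (hF : ∀ z ∈ U, HasDerivAt F (f z) z) {p : ℂ} (hFp : F p = 0) {R : ℝ} (hR : ball p R ⊆ U)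
    {z : ℂ} (hz : z ∈ ball p R) : rePrimitive U p f z = (F z).re := by
  have hex : ∃ γ : Path p z, IsC1PathIn U γ := by
    refine ⟨Path.segment p z, fun t => hR ?_, ?_⟩
    · exact (convex_ball p R).segment_subset (mem_ball_self (pos_of_mem_ball hz)) hz
        (by rw [← Path.range_segment]; exact mem_range_self t)
    · refine ContDiffOn.congr (f := AffineMap.lineMap p z) ?_ fun t ht => ?_
      · have h : ContDiff ℝ 1 fun t : ℝ => t • (z - p) + p := by fun_prop
        exact h.contDiffOn
      · rw [Path.extend_apply _ ht]; rfl
  rw [rePrimitive, dif_pos hex, lineIntegral_eq_sub hf hF hex.choose_spec, hFp, sub_zero]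

/-! ### Mollified potentials -/

/-- The real-linear form `v ↦ Re (B v)`, i.e. the value of the 1-form `Re (B dz)`. -/
noncomputable def reForm (B : ℂ) : ℂ →L[ℝ] ℝ :=
  Complex.reCLM.comp (ContinuousLinearMap.mul ℝ ℂ B)

@[simp]
theorem reForm_apply (B v : ℂ) : reForm B v = (B * v).re := rfl

theorem norm_reForm_le (B : ℂ) : ‖reForm B‖ ≤ ‖B‖ := by
  refine ContinuousLinearMap.opNorm_le_bound _ (norm_nonneg _) fun v => ?_
  rw [reForm_apply, Real.norm_eq_abs, ← norm_mul]
  exact Complex.abs_re_le_norm _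

theorem hasFDerivAt_re {F : ℂ → ℂ} {B z : ℂ} (h : HasDerivAt F B z) :
    HasFDerivAt (fun w => (F w).re) (reForm B) z := by
  have h1 := Complex.reCLM.hasFDerivAt.comp z (h.hasFDerivAt.restrictScalars ℝ)
  refine h1.congr_fderiv ?_
  ext v
  simp [mul_comm]

/-- The function `∂ψ/∂x + i ∂ψ/∂y = 2 ∂ψ/∂z̄` for a real-valued function `ψ`. -/
noncomputable def gradC (ψ : ℂ → ℝ) (z : ℂ) : ℂ :=
  (fderiv ℝ ψ z 1 : ℂ) + Complex.I * (fderiv ℝ ψ z Complex.I : ℂ)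

theorem tsupport_gradC_subset (ψ : ℂ → ℝ) : tsupport (gradC ψ) ⊆ tsupport ψ := by
  refine closure_minimal (fun z hz => ?_) isClosed_closure
  refine support_fderiv_subset ℝ (fun h => hz ?_)
  simp [gradC, h]

theorem gradC_of_notMem_tsupport {ψ : ℂ → ℝ} {z : ℂ} (hz : z ∉ tsupport ψ) : gradC ψ z = 0 :=
  image_eq_zero_of_notMem_tsupport fun h => hz (tsupport_gradC_subset ψ h)

theorem integrable_fderiv_mul {U : Opens ℂ} {Φ : ℂ → ℂ} (hΦ : LocallyIntegrableOn Φ U)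
    {ψ : ℂ → ℝ} (hψ : ContDiff ℝ ∞ ψ) (hc : HasCompactSupport ψ) (hs : tsupport ψ ⊆ U) (v : ℂ) :
    Integrable (fun z => (fderiv ℝ ψ z v : ℂ) * Φ z) := by
  rw [← integrableOn_iff_integrable_of_support_subset (s := tsupport ψ)]
  · refine (hΦ.integrableOn_compact_subset hs hc).continuousOn_mul ?_ hc
    have := hψ.continuous_fderiv (by simp)
    exact Continuous.continuousOn (by fun_prop)
  · intro z hz
    refine support_fderiv_subset ℝ fun h => hz ?_
    simp [h]

theorem integral_gradC_mul {U : Opens ℂ} {Φ : ℂ → ℂ} (hΦ : LocallyIntegrableOn Φ U)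
    {ψ : ℂ → ℝ} (hψ : ContDiff ℝ ∞ ψ) (hc : HasCompactSupport ψ) (hs : tsupport ψ ⊆ U) :
    ∫ z, gradC ψ z * Φ z = (∫ z, (fderiv ℝ ψ z 1 : ℂ) * Φ z)
      + Complex.I * ∫ z, (fderiv ℝ ψ z Complex.I : ℂ) * Φ z := by
  have h := integrable_fderiv_mul hΦ hψ hc hs
  rw [← integral_const_mul, ← integral_add (h 1) ((h _).const_mul _)]
  refine integral_congr_ae (Eventually.of_forall fun z => ?_)
  simp only [gradC]
  ring

theorem toDistribution_apply {U : Opens ℂ} {Φ : ℂ → ℂ} (hΦ : LocallyIntegrableOn Φ U)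
    (ψ : 𝓓(U, ℝ)) : toDistribution U Φ ψ = ∫ z, (ψ z : ℂ) * Φ z := by
  refine (TestFunction.integralAgainstBilinCLM_eq_integral hΦ).trans ?_
  simp

theorem toDistribution_lineDeriv_apply {U : Opens ℂ} {Φ : ℂ → ℂ} (hΦ : LocallyIntegrableOn Φ U)
    (ψ : 𝓓(U, ℝ)) (v : ℂ) :
    (∂_{v} (toDistribution U Φ)) ψ = -∫ z, (fderiv ℝ ψ z v : ℂ) * Φ z := by
  rw [Distribution.lineDerivOp_apply_apply, map_neg, toDistribution_apply hΦ]
  congr 1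

/-- Positivity of `∂Φ/∂z̄`, spelled out on test functions. -/
theorem neg_integral_gradC_mul_nonneg {U : Opens ℂ} {Φ : ℂ → ℂ} (hΦ : LocallyIntegrableOn Φ U)
    (hpos : toDistribution U Φ ∈ Sigma U) {ψ : ℂ → ℝ} (hψ : ContDiff ℝ ∞ ψ)
    (hc : HasCompactSupport ψ) (hs : tsupport ψ ⊆ U) (h0 : ∀ z, 0 ≤ ψ z) :
    0 ≤ -∫ z, gradC ψ z * Φ z := by
  let χ : 𝓓(U, ℝ) := ⟨ψ, hψ, hc, hs⟩
  have h := hpos χ h0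
  have hval : distDzbar (toDistribution U Φ) χ = (1 / 2 : ℂ) * -∫ z, gradC ψ z * Φ z := by
    have e1 : distDzbar (toDistribution U Φ) χ = (1 / 2 : ℂ) *
        ((∂_{(1 : ℂ)} (toDistribution U Φ)) χ
          + Complex.I * (∂_{Complex.I} (toDistribution U Φ)) χ) := rfl
    rw [e1, toDistribution_lineDeriv_apply hΦ, toDistribution_lineDeriv_apply hΦ,
      integral_gradC_mul hΦ hψ hc hs]
    change _ * (-(∫ z, (fderiv ℝ ψ z 1 : ℂ) * Φ z)
      + Complex.I * -(∫ z, (fderiv ℝ ψ z Complex.I : ℂ) * Φ z)) = _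
    ring
  rw [hval] at h
  have h2 : (0 : ℂ) ≤ 2 := by norm_num
  have := mul_nonneg h2 h
  rwa [← mul_assoc, mul_one_div_cancel two_ne_zero, one_mul] at this

/-- The mollification of `Ψ` at scale `δ`. -/
noncomputable def mollify (δ : ℝ) (hδ : 0 < δ) (Ψ : ℂ → ℂ) : ℂ → ℂ :=
  (ContDiffBump.normed (c := (0 : ℂ)) ⟨δ / 2, δ, half_pos hδ, half_lt_self hδ⟩ volume)
    ⋆[ContinuousLinearMap.lsmul ℝ ℝ, volume] Ψ

section mollify

variable {δ : ℝ} {hδ : 0 < δ} {Ψ : ℂ → ℂ}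

theorem contDiff_mollify (hΨ : LocallyIntegrable Ψ) : ContDiff ℝ ∞ (mollify δ hδ Ψ) :=
  (ContDiffBump.hasCompactSupport_normed _).contDiff_convolution_left _
    (ContDiffBump.contDiff_normed _) hΨ

/-- A weighted average of `Ψ` over the disc of radius `δ` lies in every closed half-plane that
contains the values of `Ψ` on that disc. -/
theorem re_mollify_mul_le (hΨ : LocallyIntegrable Ψ) {z ξ : ℂ} {m : ℝ}
    (h : ∀ᵐ w, w ∈ ball z δ → (Ψ w * ξ).re ≤ m) : (mollify δ hδ Ψ z * ξ).re ≤ m := by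
  set b : ContDiffBump (0 : ℂ) := ⟨δ / 2, δ, half_pos hδ, half_lt_self hδ⟩
  have hi : Integrable (fun w => b.normed volume (z - w) • Ψ w) := by
    have hc : HasCompactSupport (fun w => b.normed volume (z - w)) :=
      b.hasCompactSupport_normed.comp_homeomorph (Homeomorph.subLeft z)
    exact hΨ.integrable_smul_left_of_hasCompactSupport
      (b.continuous_normed.comp (continuous_const.sub continuous_id)) hc
  have e1 : mollify δ hδ Ψ z = ∫ w, b.normed volume (z - w) • Ψ w := by
    rw [mollify, convolution_eq_swap]; rfl
  have e2 : (mollify δ hδ Ψ z * ξ).re = ∫ w, b.normed volume (z - w) * (Ψ w * ξ).re := by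
    rw [e1, ← integral_mul_const, ← Complex.reCLM_apply,
      ← ContinuousLinearMap.integral_comp_comm _ (hi.mul_const ξ)]
    refine integral_congr_ae (Eventually.of_forall fun w => ?_)
    simp only [Complex.reCLM_apply, smul_mul_assoc, Complex.smul_re, smul_eq_mul]
  have hi2 : Integrable (fun w => b.normed volume (z - w) * (Ψ w * ξ).re) := by
    refine (Complex.reCLM.integrable_comp (hi.mul_const ξ)).congr
      (Eventually.of_forall fun w => ?_)
    simp only [Complex.reCLM_apply, smul_mul_assoc, Complex.smul_re, smul_eq_mul]
  have hi3 : Integrable (fun w => b.normed volume (z - w)) :=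
    b.integrable_normed.comp_sub_left z
  have e3 : ∫ w, b.normed volume (z - w) * m = m := by
    rw [integral_mul_const, integral_sub_left_eq_self (fun w => b.normed volume w) volume z,
      b.integral_normed, one_mul]
  rw [e2, ← e3]
  refine integral_mono_ae hi2 (hi3.mul_const m) ?_
  filter_upwards [h] with w hw
  by_cases hwb : w ∈ ball z δ
  · exact mul_le_mul_of_nonneg_left (hw hwb) (b.nonneg_normed _)
  · have : b.normed volume (z - w) = 0 := by
      rw [← Function.notMem_support, b.support_normed_eq, mem_ball_zero_iff, ← dist_eq_norm,
        dist_comm]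
      exact hwb
    simp [this]

/-- If `∂Ψ/∂z̄` is a real distribution on a ball, then `Re (Ψ dz)`, once mollified, is a closed
form on a smaller concentric ball and hence exact there. -/
theorem exists_hasFDerivAt_mollify (hΨ : LocallyIntegrable Ψ) {p : ℂ} {R R' : ℝ}
    (hR' : R + δ < R')
    (hreal : ∀ ψ : ℂ → ℝ, ContDiff ℝ ∞ ψ → HasCompactSupport ψ → tsupport ψ ⊆ ball p R' →
      (∀ z, 0 ≤ ψ z) → (∫ z, gradC ψ z * Ψ z).im = 0) :
    ∃ u : ℂ → ℝ, u p = 0 ∧ ∀ z ∈ ball p R, HasFDerivAt u (reForm (mollify δ hδ Ψ z)) z := by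
  set b : ContDiffBump (0 : ℂ) := ⟨δ / 2, δ, half_pos hδ, half_lt_self hδ⟩ with hb
  have hsmooth : ContDiff ℝ ∞ (mollify δ hδ Ψ) := contDiff_mollify hΨ
  have hreForm : IsBoundedLinearMap ℝ reForm :=
    { map_add := fun x y => by ext v; simp [add_mul]
      map_smul := fun c x => by ext v; simp; ring
      bound := ⟨1, one_pos, fun x => by simpa using norm_reForm_le x⟩ }
  have hd : ∀ a v w : ℂ, fderiv ℝ (fun z => reForm (mollify δ hδ Ψ z)) a v w =
      (fderiv ℝ (mollify δ hδ Ψ) a v * w).re := fun a v w => by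
    have h1 := hreForm.hasFDerivAt.comp a
      ((hsmooth.differentiable (by simp)).differentiableAt (x := a)).hasFDerivAt
    have h2 : HasFDerivAt (fun z => reForm (mollify δ hδ Ψ z)) _ a := h1
    rw [h2.fderiv]
    rfl
  have hconv : ∀ a v : ℂ, fderiv ℝ (mollify δ hδ Ψ) a v
      = ∫ w, (fderiv ℝ (b.normed volume) (a - w) v : ℂ) * Ψ w := fun a v => by
    have h1 := (b.hasCompactSupport_normed (μ := volume)).hasFDerivAt_convolution_left
      (μ := volume) (ContinuousLinearMap.lsmul ℝ ℝ : ℝ →L[ℝ] ℂ →L[ℝ] ℂ)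
      (b.contDiff_normed (n := 1)) hΨ a
    have h2 : HasFDerivAt (mollify δ hδ Ψ) _ a := h1
    have hcs : HasCompactSupport (fderiv ℝ (b.normed volume)) :=
      b.hasCompactSupport_normed.fderiv ℝ
    have hcont : Continuous (fderiv ℝ (b.normed volume)) :=
      (b.contDiff_normed (n := 1)).continuous_fderiv (by simp)
    have hex := hcs.convolutionExists_left
      ((ContinuousLinearMap.lsmul ℝ ℝ : ℝ →L[ℝ] ℂ →L[ℝ] ℂ).precompL ℂ) hcont hΨ a
    have hex' := hex.integrable_swap
    rw [h2.fderiv, convolution_eq_swap, ContinuousLinearMap.integral_apply hex']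
    refine integral_congr_ae (Eventually.of_forall fun w => ?_)
    simp [ContinuousLinearMap.precompL_apply]
  have hclosed : ∀ a ∈ ball p R, (fderiv ℝ (mollify δ hδ Ψ) a 1
      + Complex.I * fderiv ℝ (mollify δ hδ Ψ) a Complex.I).im = 0 := fun a ha => by
    set ψ : ℂ → ℝ := fun w => b.normed volume (a - w) with hψ
    have hψs : ContDiff ℝ ∞ ψ := b.contDiff_normed.comp (contDiff_const.sub contDiff_id)
    have hψc : HasCompactSupport ψ :=
      b.hasCompactSupport_normed.comp_homeomorph (Homeomorph.subLeft a)
    have hsupp : tsupport ψ ⊆ closedBall a δ := by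
      refine closure_minimal (fun w hw => ?_) isClosed_closedBall
      have : a - w ∈ Function.support (b.normed volume) := hw
      rw [b.support_normed_eq, mem_ball_zero_iff, ← dist_eq_norm, dist_comm] at this
      exact this.le
    have hsupp' : tsupport ψ ⊆ ball p R' := hsupp.trans fun w hw => by
      have h1 := dist_triangle w a p
      rw [mem_ball] at ha ⊢
      rw [mem_closedBall] at hw
      linarith
    have hψd : ∀ w v, fderiv ℝ ψ w v = -fderiv ℝ (b.normed volume) (a - w) v := fun w v => by
      have h1 : HasFDerivAt (b.normed volume) _ (a - w) :=
        ((b.contDiff_normed (n := 1)).differentiable (by simp)).differentiableAt.hasFDerivAt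
      have h2 := h1.comp w ((hasFDerivAt_id w).const_sub a)
      have h3 : HasFDerivAt ψ _ w := h2
      rw [h3.fderiv]
      simp
    have h0 := hreal ψ hψs hψc hsupp' (fun w => b.nonneg_normed _)
    have hint : ∀ v : ℂ, Integrable
        (fun w => (fderiv ℝ (b.normed volume) (a - w) v : ℂ) * Ψ w) := fun v => by
      have h1 : Continuous fun w => (fderiv ℝ (b.normed volume) (a - w) v) := by
        have hcont : Continuous (fderiv ℝ (b.normed volume)) :=
          (b.contDiff_normed (n := 1)).continuous_fderiv (by simp)
        fun_prop
      have h2 : HasCompactSupport fun w => (fderiv ℝ (b.normed volume) (a - w) v) :=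
        (b.hasCompactSupport_normed.fderiv_apply ℝ v).comp_homeomorph (Homeomorph.subLeft a)
      have := hΨ.integrable_smul_left_of_hasCompactSupport h1 h2
      simpa using this
    have e : ∫ z, gradC ψ z * Ψ z = -(fderiv ℝ (mollify δ hδ Ψ) a 1
        + Complex.I * fderiv ℝ (mollify δ hδ Ψ) a Complex.I) := by
      rw [hconv, hconv, ← integral_const_mul, ← integral_add (hint 1) ((hint _).const_mul _),
        ← integral_neg]
      refine integral_congr_ae (Eventually.of_forall fun w => ?_)
      simp only [gradC, hψd]
      push_cast
      ring
    rw [e, Complex.neg_im, neg_eq_zero] at h0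
    exact h0
  obtain ⟨u, hu⟩ : ∃ u : ℂ → ℝ, ∀ a ∈ ball p R, HasFDerivAt u (reForm (mollify δ hδ Ψ a)) a := by
    refine (convex_ball p R).exists_forall_hasFDerivAt_of_fderiv_symmetric isOpen_ball
      (fun a _ => ?_) (fun a ha x y => ?_)
    · have h := hreForm.hasFDerivAt.comp a
        ((hsmooth.differentiable (by simp)).differentiableAt (x := a)).hasFDerivAt
      exact h.differentiableAt.differentiableWithinAt
    · have h := hclosed a ha
      rw [hd, hd]
      have hx : ∀ x : ℂ, fderiv ℝ (mollify δ hδ Ψ) a x =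
          (x.re : ℂ) * fderiv ℝ (mollify δ hδ Ψ) a 1
            + (x.im : ℂ) * fderiv ℝ (mollify δ hδ Ψ) a Complex.I := fun x => by
        have : x = x.re • (1 : ℂ) + x.im • Complex.I := by
          apply Complex.ext <;> simp
        conv_lhs => rw [this]
        rw [map_add, map_smul, map_smul]
        simp
      rw [hx x, hx y]
      simp at h ⊢
      linear_combination (x.im * y.re - x.re * y.im) * h
  exact ⟨fun z => u z - u p, sub_self _, fun z hz => (hu z hz).sub_const _⟩

end mollify

/-! ### Potentials of piecewise analytic functions -/

/-- `u` is a real potential on the ball `ball p R` of the function `∑ k, A k · χ_{M k}`, where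
`F k` is a primitive of `A k`: a Lipschitz function that differs from `Re (F k)` by locally
constant functions on `M k`. The last field is the integrated form of the statement that the
gradient of `u - Re (F i)` is almost everywhere one of the gradients of `Re (F k - F i)`: along a
curve on which all `Re (F k - F i)` have nonpositive derivative, `u - Re (F i)` does not
increase. -/
structure IsPotential (p : ℂ) (R : ℝ) {r : ℕ} (M : Fin r → Set ℂ) (A F : Fin r → ℂ → ℂ)
    (u : ℂ → ℝ) : Prop where
  lipschitz : ∃ C : ℝ≥0, LipschitzOnWith C u (ball p R)
  map_center : u p = 0
  locally_eq : ∀ k, ∀ z ∈ M k ∩ ball p R, ∀ᶠ w in 𝓝 z,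
    u w - (F k w).re = u z - (F k z).re
  antitone : ∀ (i : Fin r) (γ γ' : ℝ → ℂ) (C : ℝ), (∀ t ∈ Icc (0 : ℝ) 1, γ t ∈ ball p R) →
    (∀ t ∈ Icc (0 : ℝ) 1, HasDerivAt γ (γ' t) t) → (∀ t ∈ Icc (0 : ℝ) 1, ‖γ' t‖ ≤ C) →
    (∀ t ∈ Icc (0 : ℝ) 1, ∀ k, ((A k (γ t) - A i (γ t)) * γ' t).re ≤ 0) →
    u (γ 1) - (F i (γ 1)).re ≤ u (γ 0) - (F i (γ 0)).re

section

variable {U : Opens ℂ} {r : ℕ} {M : Fin r → Set ℂ} {A : Fin r → ℂ → ℂ} {Φ : ℂ → ℂ}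

theorem IsPiecewiseAnalytic.sum_indicator_eq (hΦ : IsPiecewiseAnalytic U M A Φ) {k : Fin r} {z : ℂ}
    (hz : z ∈ M k) : ∑ i, (M i).indicator (A i) z = A k z := by
  rw [Finset.sum_eq_single k, indicator_of_mem hz]
  · intro j _ hj
    exact indicator_of_notMem (fun h => (hΦ.disjoint hj).le_bot ⟨h, hz⟩) _
  · simp

theorem IsPiecewiseAnalytic.ae_mem (hΦ : IsPiecewiseAnalytic U M A Φ) :
    ∀ᵐ z, z ∈ U → ∃ k, z ∈ M k := by
  have h := hΦ.null_compl
  rw [measure_eq_zero_iff_ae_notMem] at h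
  filter_upwards [h] with z hz hzU
  by_contra hcon
  exact hz ⟨hzU, by simpa using hcon⟩

theorem IsPiecewiseAnalytic.ae_eq_of_mem (hΦ : IsPiecewiseAnalytic U M A Φ) :
    ∀ᵐ z, ∀ k, z ∈ M k → Φ z = A k z := by
  have h := (ae_restrict_iff' U.isOpen.measurableSet).1 hΦ.ae_eq
  filter_upwards [h] with z hz k hk
  rw [hz (hΦ.subset k hk), hΦ.sum_indicator_eq hk]

theorem IsPiecewiseAnalytic.locallyIntegrableOn (hΦ : IsPiecewiseAnalytic U M A Φ) :
    LocallyIntegrableOn Φ U := by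
  rw [locallyIntegrableOn_iff U.isOpen.isLocallyClosed]
  intro K hKU hK
  have h1 : ∀ᵐ z ∂volume.restrict K, Φ z = ∑ i, (M i).indicator (A i) z :=
    ae_mono (Measure.restrict_mono hKU le_rfl) hΦ.ae_eq
  have h2 : Integrable (fun z => ∑ i, (M i).indicator (A i) z) (volume.restrict K) :=
    integrable_finsetSum _ fun i _ =>
      (((hΦ.analytic i).continuousOn.mono hKU).integrableOn_compact hK).indicator
        (hΦ.isOpen i).measurableSet
  exact h2.congr (h1.mono fun z hz => hz.symm)

theorem exists_isPotential (hΦ : IsPiecewiseAnalytic U M A Φ)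
    (hpos : toDistribution U Φ ∈ Sigma U) {F : Fin r → ℂ → ℂ}
    (hF : ∀ i, ∀ z ∈ U, HasDerivAt (F i) (A i z) z) {p : ℂ} {R R' : ℝ} (hR : 0 < R)
    (hRR' : R < R') (hRU : closedBall p R' ⊆ U) : ∃ u, IsPotential p R M A F u := by
  set K := closedBall p R' with hKdef
  have hK : IsCompact K := isCompact_closedBall p R'
  have hRK : ball p R ⊆ K := (ball_subset_ball hRR'.le).trans ball_subset_closedBall
  -- Cutting `Φ` off outside `K` makes it integrable.
  set Ψ : ℂ → ℂ := fun z => ∑ i, (K ∩ M i).indicator (A i) z with hΨdef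
  have hΨint : Integrable Ψ := integrable_finsetSum _ fun i _ => by
    rw [integrable_indicator_iff (hK.measurableSet.inter (hΦ.isOpen i).measurableSet)]
    exact (((hΦ.analytic i).continuousOn.mono hRU).integrableOn_compact hK).mono_set
      inter_subset_left
  have hΨA : ∀ k, ∀ z ∈ K ∩ M k, Ψ z = A k z := fun k z hz => by
    rw [← hΦ.sum_indicator_eq hz.2]
    refine Finset.sum_congr rfl fun i _ => ?_
    by_cases h : z ∈ M i
    · rw [indicator_of_mem h, indicator_of_mem (s := K ∩ M i) ⟨hz.1, h⟩]
    · rw [indicator_of_notMem h, indicator_of_notMem (s := K ∩ M i) fun h' => h h'.2]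
  have hreal : ∀ ψ : ℂ → ℝ, ContDiff ℝ ∞ ψ → HasCompactSupport ψ → tsupport ψ ⊆ ball p R' →
      (∀ z, 0 ≤ ψ z) → (∫ z, gradC ψ z * Ψ z).im = 0 := fun ψ h1 h2 h3 h4 => by
    have h5 := neg_integral_gradC_mul_nonneg hΦ.locallyIntegrableOn hpos h1 h2
      (h3.trans (ball_subset_closedBall.trans hRU)) h4
    have h6 : ∫ z, gradC ψ z * Ψ z = ∫ z, gradC ψ z * Φ z := by
      refine integral_congr_ae ?_
      filter_upwards [hΦ.ae_mem, hΦ.ae_eq_of_mem] with z hz1 hz2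
      by_cases hz : z ∈ tsupport ψ
      · have hzK : z ∈ K := ball_subset_closedBall (h3 hz)
        obtain ⟨k, hk⟩ := hz1 (hRU hzK)
        rw [hz2 k hk, hΨA k z ⟨hzK, hk⟩]
      · rw [gradC_of_notMem_tsupport hz, zero_mul, zero_mul]
    have h7 := (Complex.le_def.1 h5).2
    rw [h6]
    simpa using h7.symm
  -- Uniform bounds and a common modulus of continuity for the `A k` on `K`.
  have hAcont : ContinuousOn (fun z k => A k z) K :=
    continuousOn_pi.2 fun k => (hΦ.analytic k).continuousOn.mono hRU
  obtain ⟨C₀, hC₀⟩ := hK.exists_bound_of_continuousOn hAcont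
  set C : ℝ≥0 := C₀.toNNReal
  have hAC : ∀ z ∈ K, ∀ k, ‖A k z‖ ≤ C := fun z hz k =>
    ((norm_le_pi_norm (fun k => A k z) k).trans (hC₀ z hz)).trans (Real.le_coe_toNNReal _)
  have hAunif : ∀ ε > 0, ∃ η > 0, ∀ z ∈ K, ∀ w ∈ K, dist w z < η → ∀ k, ‖A k w - A k z‖ ≤ ε := by
    intro ε hε
    obtain ⟨η, hη, h⟩ := Metric.uniformContinuousOn_iff.1
      (hK.uniformContinuousOn_of_continuous hAcont) ε hε
    refine ⟨η, hη, fun z hz w hw hd k => ?_⟩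
    have h1 := (h w hw z hz hd).le
    rw [dist_eq_norm] at h1
    exact (norm_le_pi_norm ((fun k => A k w) - fun k => A k z) k).trans h1
  -- The mollified potentials.
  set δ : ℕ → ℝ := fun n => (R' - R) / (n + 2) with hδdef
  have hδ : ∀ n, 0 < δ n := fun n => div_pos (sub_pos.2 hRR') (by positivity)
  have hδlt : ∀ n, R + δ n < R' := fun n => by
    have h1 : δ n < R' - R := by
      refine div_lt_self (sub_pos.2 hRR') ?_
      have : (0 : ℝ) ≤ n := n.cast_nonneg
      linarith
    linarith
  have hδlim : Tendsto δ atTop (𝓝 0) := by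
    have h1 : Tendsto (fun n : ℕ => (n : ℝ) + 2) atTop atTop :=
      tendsto_atTop_add_const_right _ _ tendsto_natCast_atTop_atTop
    exact h1.const_div_atTop _
  have hballK : ∀ n, ∀ z ∈ ball p R, ball z (δ n) ⊆ K := fun n z hz w hw => by
    have h1 := dist_triangle w z p
    have h2 := hδlt n
    rw [mem_ball] at hz hw
    rw [hKdef, mem_closedBall]
    linarith
  choose v hvp hv using fun n => exists_hasFDerivAt_mollify (hδ := hδ n)
    hΨint.locallyIntegrable (hδlt n) hreal
  have hae : ∀ᵐ w, w ∈ K → ∃ k, w ∈ M k ∧ Ψ w = A k w := by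
    filter_upwards [hΦ.ae_mem] with w hw hwK
    obtain ⟨k, hk⟩ := hw (hRU hwK)
    exact ⟨k, hk, hΨA k w ⟨hwK, hk⟩⟩
  have hre_le : ∀ B ξ : ℂ, (B * ξ).re ≤ ‖B‖ * ‖ξ‖ := fun B ξ =>
    (Complex.re_le_norm _).trans (norm_mul B ξ).le
  have hmoll_bound : ∀ n, ∀ z ∈ ball p R, ‖reForm (mollify (δ n) (hδ n) Ψ z)‖ ≤ C := by
    intro n z hz
    have h1 : ∀ ξ, (mollify (δ n) (hδ n) Ψ z * ξ).re ≤ C * ‖ξ‖ := fun ξ => by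
      refine re_mollify_mul_le hΨint.locallyIntegrable ?_
      filter_upwards [hae] with w hw hwb
      obtain ⟨k, -, hk⟩ := hw (hballK n z hz hwb)
      rw [hk]
      exact (hre_le _ _).trans
        (mul_le_mul_of_nonneg_right (hAC w (hballK n z hz hwb) k) (norm_nonneg _))
    refine ContinuousLinearMap.opNorm_le_bound _ C.coe_nonneg fun ξ => ?_
    rw [reForm_apply, Real.norm_eq_abs, abs_le]
    refine ⟨?_, h1 ξ⟩
    have h2 := h1 (-ξ)
    rw [mul_neg, Complex.neg_re, norm_neg] at h2
    linarith
  have hvlip : ∀ n, ∀ z ∈ ball p R, ∀ w ∈ ball p R, ‖v n w - v n z‖ ≤ C * ‖w - z‖ :=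
    fun n z hz w hw => (convex_ball p R).norm_image_sub_le_of_norm_hasFDerivWithin_le
      (fun x hx => (hv n x hx).hasFDerivWithinAt) (hmoll_bound n) hz hw
  -- A limit of the bounded sequence `v n` along an ultrafilter.
  have hlim : ∀ z, ∃ l, z ∈ ball p R → Tendsto (fun n => v n z) (hyperfilter ℕ : Filter ℕ) (𝓝 l) := by
    intro z
    by_cases hz : z ∈ ball p R
    · have hmem : ∀ n, v n z ∈ closedBall (0 : ℝ) (C * R) := fun n => by
        have h1 := hvlip n p (mem_ball_self hR) z hz
        rw [hvp, sub_zero] at h1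
        rw [mem_closedBall_zero_iff]
        rw [mem_ball, dist_eq_norm] at hz
        exact h1.trans (mul_le_mul_of_nonneg_left hz.le C.coe_nonneg)
      obtain ⟨l, -, hl⟩ := (isCompact_closedBall (0 : ℝ) (C * R)).ultrafilter_le_nhds'
        ((hyperfilter ℕ).map fun n => v n z) (Ultrafilter.mem_map.2 (univ_mem' hmem))
      exact ⟨l, fun _ => hl⟩
    · exact ⟨0, fun h => absurd h hz⟩
  choose u hu using hlim
  have hultra : (hyperfilter ℕ : Filter ℕ) ≤ atTop := Nat.hyperfilter_le_atTop
  -- Passing to the limit in the increments of `v n` along a curve.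
  have hcurve : ∀ (i : Fin r) (γ γ' : ℝ → ℂ) (C' : ℝ), (∀ t ∈ Icc (0 : ℝ) 1, γ t ∈ ball p R) →
      (∀ t ∈ Icc (0 : ℝ) 1, HasDerivAt γ (γ' t) t) → (∀ t ∈ Icc (0 : ℝ) 1, ‖γ' t‖ ≤ C') →
      (∀ ε > 0, ∀ᶠ n in atTop, ∀ t ∈ Icc (0 : ℝ) 1,
        ((mollify (δ n) (hδ n) Ψ (γ t) - A i (γ t)) * γ' t).re ≤ ε * ‖γ' t‖) →
      u (γ 1) - (F i (γ 1)).re ≤ u (γ 0) - (F i (γ 0)).re := by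
    intro i γ γ' C' hγ hγd hγC h
    have h0 : (0 : ℝ) ∈ Icc (0 : ℝ) 1 := left_mem_Icc.2 zero_le_one
    have h1 : (1 : ℝ) ∈ Icc (0 : ℝ) 1 := right_mem_Icc.2 zero_le_one
    have hC' : 0 ≤ C' := (norm_nonneg _).trans (hγC 0 h0)
    refine le_of_forall_pos_le_add fun ε hε => ?_
    have hstep : ∀ᶠ n in atTop,
        v n (γ 1) - (F i (γ 1)).re ≤ v n (γ 0) - (F i (γ 0)).re + ε := by
      filter_upwards [h (ε / (C' + 1)) (by positivity)] with n hn
      have hd : ∀ t ∈ Icc (0 : ℝ) 1, HasDerivAt (fun t => v n (γ t) - (F i (γ t)).re)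
          (((mollify (δ n) (hδ n) Ψ (γ t) - A i (γ t)) * γ' t).re) t := fun t ht => by
        have e1 := (hv n _ (hγ t ht)).comp_hasDerivAt t (hγd t ht)
        have e2 := (hasFDerivAt_re (hF i _ (hRU (hRK (hγ t ht))))).comp_hasDerivAt t (hγd t ht)
        have e3 := e1.sub e2
        rw [reForm_apply, reForm_apply, ← Complex.sub_re, ← sub_mul] at e3
        exact e3
      have hle := (convex_Icc (0 : ℝ) 1).image_sub_le_mul_sub_of_deriv_le (C := ε)
        (fun t ht => (hd t ht).continuousAt.continuousWithinAt)
        (fun t ht => (hd t (interior_subset ht)).differentiableAt.differentiableWithinAt)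
        (fun t ht => ?_) 0 h0 1 h1 zero_le_one
      · linarith
      · have ht' := interior_subset ht
        rw [(hd t ht').deriv]
        refine (hn t ht').trans ?_
        calc ε / (C' + 1) * ‖γ' t‖ ≤ ε / (C' + 1) * (C' + 1) := by
              refine mul_le_mul_of_nonneg_left ?_ (by positivity)
              linarith [hγC t ht']
          _ = ε := div_mul_cancel₀ _ (by positivity)
    exact le_of_tendsto_of_tendsto ((hu _ (hγ 1 h1)).sub_const _)
      (((hu _ (hγ 0 h0)).sub_const _).add_const _) (hultra hstep)
  -- The mollification at `z` is an average of values close to the `A k z`, for the `M k` near `z`.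
  have hest : ∀ ε > 0, ∀ᶠ n in atTop, ∀ z ∈ ball p R, ∀ i ξ,
      (∀ k, (ball z (δ n) ∩ M k).Nonempty → ((A k z - A i z) * ξ).re ≤ 0) →
      ((mollify (δ n) (hδ n) Ψ z - A i z) * ξ).re ≤ ε * ‖ξ‖ := by
    intro ε hε
    obtain ⟨η, hη, hA⟩ := hAunif ε hε
    filter_upwards [hδlim.eventually_lt_const hη] with n hn z hz i ξ hk
    rw [sub_mul, Complex.sub_re, sub_le_iff_le_add]
    refine re_mollify_mul_le hΨint.locallyIntegrable ?_
    filter_upwards [hae] with w hw hwb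
    obtain ⟨k, hkM, hkΨ⟩ := hw (hballK n z hz hwb)
    have e1 := hk k ⟨w, hwb, hkM⟩
    have e2 := (hre_le (A k w - A k z) ξ).trans (mul_le_mul_of_nonneg_right
      (hA z (hRK hz) w (hballK n z hz hwb) ((mem_ball.1 hwb).trans hn) k) (norm_nonneg _))
    rw [sub_mul, Complex.sub_re] at e1 e2
    rw [hkΨ]
    linarith
  refine ⟨u, ⟨C, LipschitzOnWith.of_dist_le_mul fun z hz w hw => ?_⟩, ?_, ?_, ?_⟩
  · rw [dist_eq_norm, dist_eq_norm]
    exact le_of_tendsto ((hu z hz).sub (hu w hw)).norm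
      (Eventually.of_forall fun n => hvlip n w hw z hz)
  · refine tendsto_nhds_unique (hu p (mem_ball_self hR)) ?_
    simp only [hvp]
    exact tendsto_const_nhds
  · rintro k z ⟨hzM, hzb⟩
    obtain ⟨ρ, hρ, hsub⟩ := Metric.isOpen_iff.1 ((hΦ.isOpen k).inter isOpen_ball) z ⟨hzM, hzb⟩
    have hseg : ∀ a ∈ ball z (ρ / 2), ∀ b ∈ ball z (ρ / 2),
        u b - (F k b).re ≤ u a - (F k a).re := by
      intro a ha b hb
      have hmem : ∀ t ∈ Icc (0 : ℝ) 1, a + t • (b - a) ∈ ball z (ρ / 2) := fun t ht =>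
        (convex_ball z (ρ / 2)).add_smul_sub_mem ha hb ht
      have h := hcurve k (fun t => a + t • (b - a)) (fun _ => b - a) ‖b - a‖
        (fun t ht => (hsub (ball_subset_ball (half_le_self hρ.le) (hmem t ht))).2)
        (fun t _ => by
          have := ((hasDerivAt_id t).smul_const (b - a)).const_add a
          rwa [one_smul] at this)
        (fun t _ => le_rfl)
        (fun ε hε => by
          filter_upwards [hest ε hε, hδlim.eventually_lt_const (half_pos hρ)] with n hn hnρ t ht
          refine hn _ (hsub (ball_subset_ball (half_le_self hρ.le) (hmem t ht))).2 k _ ?_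
          rintro j ⟨w, hwb, hwj⟩
          have hwk : w ∈ M k := by
            refine (hsub ?_).1
            have e1 := dist_triangle w (a + t • (b - a)) z
            have e2 := mem_ball.1 (hmem t ht)
            rw [mem_ball] at hwb ⊢
            linarith
          have hjk : j = k := by
            by_contra hne
            exact (hΦ.disjoint hne).le_bot ⟨hwj, hwk⟩
          simp [hjk])
      simpa using h
    filter_upwards [ball_mem_nhds z (half_pos hρ)] with w hw
    exact le_antisymm (hseg z (mem_ball_self (half_pos hρ)) w hw)
      (hseg w hw z (mem_ball_self (half_pos hρ)))
  · intro i γ γ' C' hγ hγd hγC hγA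
    refine hcurve i γ γ' C' hγ hγd hγC fun ε hε => ?_
    filter_upwards [hest ε hε] with n hn t ht
    exact hn _ (hγ t ht) i _ fun k _ => hγA t ht k

end

/-! ### Weak derivatives and weak subharmonicity -/

theorem integral_mul_fderiv_eq {w : ℂ → ℝ} {B : ℂ → ℂ} {p : ℂ} {R : ℝ} {C : ℝ≥0}
    (hw : LipschitzOnWith C w (ball p R))
    (hB : ∀ᵐ z, z ∈ ball p R → HasFDerivAt w (reForm (B z)) z) {χ : ℂ → ℝ}
    (hχ : ContDiff ℝ 1 χ) (hc : HasCompactSupport χ) (hs : tsupport χ ⊆ ball p R) (v : ℂ) :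
    ∫ z, w z * fderiv ℝ χ z v = -∫ z, (B z * v).re * χ z := by
  -- Rademacher's integration by parts formula asks for globally Lipschitz functions.
  obtain ⟨g, hg, hgw⟩ := hw.extend_real
  obtain ⟨D, hD⟩ := hχ.lipschitzWith_of_hasCompactSupport hc (by simp)
  have h := LipschitzWith.integral_lineDeriv_mul_eq (μ := volume) hg hD hc v
  have e1 : ∫ z, lineDeriv ℝ g z v * χ z = ∫ z, (B z * v).re * χ z := by
    refine integral_congr_ae ?_
    filter_upwards [hB] with z hz
    by_cases hzs : z ∈ tsupport χ
    · have hzb := hs hzs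
      have hd : HasFDerivAt g (reForm (B z)) z := (hz hzb).congr_of_eventuallyEq
        (Filter.mem_of_superset (isOpen_ball.mem_nhds hzb) fun y hy => (hgw hy).symm)
      rw [(hd.hasLineDerivAt v).lineDeriv, reForm_apply]
    · rw [image_eq_zero_of_notMem_tsupport hzs, mul_zero, mul_zero]
  have e2 : ∫ z, lineDeriv ℝ χ z (-v) * g z = -∫ z, w z * fderiv ℝ χ z v := by
    rw [← integral_neg]
    refine integral_congr_ae (Eventually.of_forall fun z => ?_)
    simp only
    rw [(hχ.differentiable (by simp)).differentiableAt.lineDeriv_eq_fderiv, map_neg]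
    by_cases hzs : z ∈ tsupport χ
    · rw [hgw (hs hzs)]; ring
    · have : fderiv ℝ χ z = 0 := by
        by_contra h
        exact hzs (support_fderiv_subset ℝ h)
      simp [this]
  rw [e1, e2] at h
  rw [h, neg_neg]

/-- The Laplacian of a function on the plane. -/
noncomputable def lap (ψ : ℂ → ℝ) (z : ℂ) : ℝ :=
  fderiv ℝ (fun y => fderiv ℝ ψ y 1) z 1
    + fderiv ℝ (fun y => fderiv ℝ ψ y Complex.I) z Complex.I

theorem contDiff_fderiv_apply {ψ : ℂ → ℝ} (h : ContDiff ℝ ∞ ψ) (v : ℂ) :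
    ContDiff ℝ ∞ fun y => fderiv ℝ ψ y v :=
  (h.fderiv_right (m := ∞) (by simp)).clm_apply contDiff_const

theorem continuous_lap {ψ : ℂ → ℝ} (h : ContDiff ℝ ∞ ψ) : Continuous (lap ψ) :=
  (contDiff_fderiv_apply (contDiff_fderiv_apply h 1) 1).continuous.add
    (contDiff_fderiv_apply (contDiff_fderiv_apply h Complex.I) Complex.I).continuous

theorem lap_of_notMem_tsupport {ψ : ℂ → ℝ} {z : ℂ} (hz : z ∉ tsupport ψ) : lap ψ z = 0 := by
  have h : ∀ v, fderiv ℝ (fun y => fderiv ℝ ψ y v) z v = 0 := fun v =>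
    image_eq_zero_of_notMem_tsupport (f := fun z => fderiv ℝ (fun y => fderiv ℝ ψ y v) z v)
      fun h => hz (tsupport_fderiv_apply_subset ℝ v (f := ψ) (tsupport_fderiv_apply_subset ℝ v h))
  rw [lap, h, h, add_zero]

theorem integral_mul_lap_eq {w : ℂ → ℝ} {B : ℂ → ℂ} {p : ℂ} {R : ℝ} {C : ℝ≥0} {U : Opens ℂ}
    (hU : ball p R ⊆ U) (hBint : LocallyIntegrableOn B U)
    (hw : LipschitzOnWith C w (ball p R))
    (hB : ∀ᵐ z, z ∈ ball p R → HasFDerivAt w (reForm (B z)) z) {ψ : ℂ → ℝ}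
    (hψ : ContDiff ℝ ∞ ψ) (hc : HasCompactSupport ψ) (hs : tsupport ψ ⊆ ball p R) :
    ∫ z, w z * lap ψ z = -(∫ z, gradC ψ z * B z).re := by
  have hint : ∀ v, Integrable fun z => w z * fderiv ℝ (fun y => fderiv ℝ ψ y v) z v := fun v => by
    have hsub : tsupport (fun z => fderiv ℝ (fun y => fderiv ℝ ψ y v) z v) ⊆ tsupport ψ :=
      (tsupport_fderiv_apply_subset ℝ v).trans (tsupport_fderiv_apply_subset ℝ v (f := ψ))
    rw [← integrableOn_iff_integrable_of_support_subset (s := tsupport ψ)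
      fun z hz => hsub (subset_tsupport _ (right_ne_zero_of_mul hz))]
    exact ((hw.continuousOn.mono hs).mul
      (contDiff_fderiv_apply (contDiff_fderiv_apply hψ v) v).continuous.continuousOn).integrableOn_compact
      hc
  have hstep : ∀ v, ∫ z, w z * fderiv ℝ (fun y => fderiv ℝ ψ y v) z v =
      -((∫ z, (fderiv ℝ ψ z v : ℂ) * B z) * v).re := fun v => by
    have h := tsupport_fderiv_apply_subset ℝ v (f := ψ)
    rw [integral_mul_fderiv_eq hw hB ((contDiff_fderiv_apply hψ v).of_le (by simp))
      (hc.of_isClosed_subset (isClosed_tsupport _) h) (h.trans hs) v, ← integral_mul_const,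
      ← Complex.reCLM_apply, ← ContinuousLinearMap.integral_comp_comm _
        ((integrable_fderiv_mul hBint hψ hc (hs.trans hU) v).mul_const v)]
    congr 1
    refine integral_congr_ae (Eventually.of_forall fun z => ?_)
    simp only [Complex.reCLM_apply, mul_assoc, Complex.re_ofReal_mul]
    ring
  simp_rw [lap, mul_add]
  rw [integral_add (hint 1) (hint _), hstep, hstep, integral_gradC_mul hBint hψ hc (hs.trans hU),
    mul_one, mul_comm Complex.I, Complex.add_re]
  ring

theorem lipschitzOnWith_re {F B : ℂ → ℂ} {p : ℂ} {R : ℝ}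
    (hF : ∀ z ∈ ball p R, HasDerivAt F (B z) z) (hB : ContinuousOn B (closedBall p R)) :
    ∃ C : ℝ≥0, LipschitzOnWith C (fun z => (F z).re) (ball p R) := by
  obtain ⟨C, hC⟩ := (isCompact_closedBall p R).exists_bound_of_continuousOn hB
  refine ⟨C.toNNReal, (convex_ball p R).lipschitzOnWith_of_nnnorm_hasFDerivWithin_le
    (fun z hz => (hasFDerivAt_re (hF z hz)).hasFDerivWithinAt) fun z hz => ?_⟩
  rw [← NNReal.coe_le_coe, coe_nnnorm]
  exact (norm_reForm_le _).trans ((hC z (ball_subset_closedBall hz)).trans (Real.le_coe_toNNReal _))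

theorem re_integral_gradC_mul_eq_zero {U : Opens ℂ} {A : ℂ → ℂ} (hA : AnalyticOnNhd ℂ A U) {p : ℂ}
    {R : ℝ} (hU : closedBall p R ⊆ U) {ψ : ℂ → ℝ} (hψ : ContDiff ℝ ∞ ψ)
    (hc : HasCompactSupport ψ) (hs : tsupport ψ ⊆ ball p R) :
    (∫ z, gradC ψ z * A z).re = 0 := by
  have hbU := ball_subset_closedBall.trans hU
  have hAint : LocallyIntegrableOn A U :=
    hA.continuousOn.locallyIntegrableOn U.isOpen.measurableSet
  have hd : ∀ z ∈ U, HasDerivAt A (deriv A z) z := fun z hz =>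
    (hA z hz).differentiableAt.hasDerivAt
  have hd' : ∀ z ∈ U, HasDerivAt (fun z => -Complex.I * A z) (-Complex.I * deriv A z) z :=
    fun z hz => (hd z hz).const_mul _
  have hcont : ContinuousOn (deriv A) (closedBall p R) := hA.deriv.continuousOn.mono hU
  obtain ⟨C₁, h₁⟩ := lipschitzOnWith_re (fun z hz => hd z (hbU hz)) hcont
  obtain ⟨C₂, h₂⟩ := lipschitzOnWith_re (fun z hz => hd' z (hbU hz)) (hcont.const_mul _)
  have e₁ := integral_mul_fderiv_eq h₁
    (Eventually.of_forall fun z hz => hasFDerivAt_re (hd z (hbU hz)))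
    (hψ.of_le (by simp)) hc hs 1
  have e₂ := integral_mul_fderiv_eq h₂
    (Eventually.of_forall fun z hz => hasFDerivAt_re (hd' z (hbU hz)))
    (hψ.of_le (by simp)) hc hs Complex.I
  -- Both sides are `-∫ Re A' · ψ`, by the Cauchy-Riemann equations.
  have e₃ : ∀ z, -Complex.I * deriv A z * Complex.I = deriv A z * 1 := fun z => by
    linear_combination (-deriv A z) * Complex.I_mul_I
  simp_rw [e₃] at e₂
  have hre : ∀ v c : ℂ, (c * ∫ z, (fderiv ℝ ψ z v : ℂ) * A z).re
      = ∫ z, (c * A z).re * fderiv ℝ ψ z v := fun v c => by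
    rw [← integral_const_mul, ← Complex.reCLM_apply, ← ContinuousLinearMap.integral_comp_comm _
      ((integrable_fderiv_mul hAint hψ hc (hs.trans hbU) v).const_mul c)]
    refine integral_congr_ae (Eventually.of_forall fun z => ?_)
    simp only [Complex.reCLM_apply]
    rw [mul_left_comm, Complex.re_ofReal_mul, mul_comm]
  have h1 := hre 1 1
  have h2 := hre Complex.I Complex.I
  simp only [one_mul] at h1
  rw [integral_gradC_mul hAint hψ hc (hs.trans hbU), Complex.add_re, h1, h2]
  have h3 : ∀ z, (Complex.I * A z).re * fderiv ℝ ψ z Complex.I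
      = -((-Complex.I * A z).re * fderiv ℝ ψ z Complex.I) := fun z => by simp
  simp_rw [h3]
  rw [integral_neg, e₁, e₂]
  ring

/-- Subharmonicity in the sense of distributions, for functions on an open set `D`. -/
def IsWeaklySubharmonicOn (v : ℂ → ℝ) (D : Set ℂ) : Prop :=
  ∀ ψ : ℂ → ℝ, ContDiff ℝ ∞ ψ → HasCompactSupport ψ → tsupport ψ ⊆ D → (∀ z, 0 ≤ ψ z) →
    0 ≤ ∫ z, v z * lap ψ z

theorem IsPotential.hasFDerivAt {p : ℂ} {R : ℝ} {r : ℕ} {M : Fin r → Set ℂ}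
    {A F : Fin r → ℂ → ℂ} {u : ℂ → ℝ} (hu : IsPotential p R M A F u) {k : Fin r} {z : ℂ}
    (hz : z ∈ M k ∩ ball p R) (hF : HasDerivAt (F k) (A k z) z) :
    HasFDerivAt u (reForm (A k z)) z := by
  refine ((hasFDerivAt_re hF).add_const (u z - (F k z).re)).congr_of_eventuallyEq ?_
  filter_upwards [hu.locally_eq k z hz] with w hw
  linarith

section

variable {U : Opens ℂ} {r : ℕ} {M : Fin r → Set ℂ} {A F : Fin r → ℂ → ℂ} {Φ : ℂ → ℂ} {p : ℂ}
  {R : ℝ} {u : ℂ → ℝ}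

theorem IsPotential.ae_hasFDerivAt (hu : IsPotential p R M A F u)
    (hΦ : IsPiecewiseAnalytic U M A Φ) (hF : ∀ i, ∀ z ∈ U, HasDerivAt (F i) (A i z) z)
    (hRU : ball p R ⊆ U) : ∀ᵐ z, z ∈ ball p R → HasFDerivAt u (reForm (Φ z)) z := by
  filter_upwards [hΦ.ae_mem, hΦ.ae_eq_of_mem] with z h1 h2 hz
  obtain ⟨k, hk⟩ := h1 (hRU hz)
  rw [h2 k hk]
  exact hu.hasFDerivAt ⟨hk, hz⟩ (hF k z (hRU hz))

theorem IsPotential.isWeaklySubharmonicOn (hu : IsPotential p R M A F u)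
    (hΦ : IsPiecewiseAnalytic U M A Φ) (hpos : toDistribution U Φ ∈ Sigma U)
    (hF : ∀ i, ∀ z ∈ U, HasDerivAt (F i) (A i z) z) (hRU : closedBall p R ⊆ U) (i : Fin r) :
    IsWeaklySubharmonicOn (fun z => u z - (F i z).re) (ball p R) := by
  intro ψ hψ hc hs h0
  have hbU := ball_subset_closedBall.trans hRU
  obtain ⟨C₁, h₁⟩ := hu.lipschitz
  obtain ⟨C₂, h₂⟩ := lipschitzOnWith_re (fun z hz => hF i z (hbU hz))
    ((hΦ.analytic i).continuousOn.mono hRU)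
  have hAint : LocallyIntegrableOn (A i) U :=
    (hΦ.analytic i).continuousOn.locallyIntegrableOn U.isOpen.measurableSet
  have e₁ := integral_mul_lap_eq hbU hΦ.locallyIntegrableOn h₁ (hu.ae_hasFDerivAt hΦ hF hbU)
    hψ hc hs
  have e₂ := integral_mul_lap_eq hbU hAint h₂
    (Eventually.of_forall fun z hz => hasFDerivAt_re (hF i z (hbU hz))) hψ hc hs
  rw [re_integral_gradC_mul_eq_zero (hΦ.analytic i) hRU hψ hc hs] at e₂
  have hint : ∀ w : ℂ → ℝ, ContinuousOn w (ball p R) → Integrable fun z => w z * lap ψ z := by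
    intro w hw
    rw [← integrableOn_iff_integrable_of_support_subset (s := tsupport ψ)]
    · exact ((hw.mono hs).mul (continuous_lap hψ).continuousOn).integrableOn_compact hc
    · intro z hz
      by_contra h
      exact hz (by simp [lap_of_notMem_tsupport h])
  have h := (Complex.le_def.1
    (neg_integral_gradC_mul_nonneg hΦ.locallyIntegrableOn hpos hψ hc (hs.trans hbU) h0)).1
  simp only [sub_mul]
  rw [integral_sub (hint _ h₁.continuousOn) (hint _ h₂.continuousOn), e₁, e₂]
  simpa using h

end

/-! ### The strong maximum principle for weakly subharmonic functions -/

theorem integral_lap_eq_zero {ψ : ℂ → ℝ} (hψ : ContDiff ℝ ∞ ψ) (hc : HasCompactSupport ψ) :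
    ∫ z, lap ψ z = 0 := by
  obtain ⟨R, hR⟩ := hc.isBounded.subset_ball (0 : ℂ)
  have h := integral_mul_lap_eq (w := fun _ => 1) (B := 0) (p := 0) (R := R) (U := ⊤)
    (fun _ _ => trivial) ((locallyIntegrable_zero).locallyIntegrableOn _)
    (LipschitzWith.const' (K := 0) (1 : ℝ)).lipschitzOnWith
    (Eventually.of_forall fun z _ => by
      have : reForm ((0 : ℂ → ℂ) z) = 0 := by ext; simp
      rw [this]
      exact hasFDerivAt_const _ _) hψ hc hR
  simpa using h

theorem hasDerivAt_expNegInvGlue (x : ℝ) :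
    HasDerivAt expNegInvGlue (x⁻¹ ^ 2 * expNegInvGlue x) x := by
  simpa using expNegInvGlue.hasDerivAt_polynomial_eval_inv_mul 1 x

theorem hasDerivAt_inv_sq_mul_expNegInvGlue (x : ℝ) :
    HasDerivAt (fun x => x⁻¹ ^ 2 * expNegInvGlue x)
      ((x⁻¹ ^ 4 - 2 * x⁻¹ ^ 3) * expNegInvGlue x) x := by
  have h := expNegInvGlue.hasDerivAt_polynomial_eval_inv_mul (Polynomial.X ^ 2) x
  simp only [Polynomial.eval_pow, Polynomial.eval_X, Polynomial.eval_mul, Polynomial.eval_sub,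
    Polynomial.derivative_X_pow, Polynomial.eval_C] at h
  convert h using 1
  push_cast
  ring

/-- The barrier of Hopf's lemma: a smooth nonnegative function that vanishes outside the disc of
radius `R` about `x₀`. -/
noncomputable def barrier (x₀ : ℂ) (R α : ℝ) (z : ℂ) : ℝ :=
  expNegInvGlue ((R ^ 2 - ‖z - x₀‖ ^ 2) / α)

section barrier

variable {x₀ : ℂ} {R α : ℝ}

theorem contDiff_barrier : ContDiff ℝ ∞ (barrier x₀ R α) := by
  have h : ContDiff ℝ ∞ fun z : ℂ => (R ^ 2 - ‖z - x₀‖ ^ 2) / α :=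
    (contDiff_const.sub ((contDiff_id.sub contDiff_const).norm_sq ℝ)).div_const _
  exact expNegInvGlue.contDiff.comp h

theorem tsupport_barrier_subset (hR : 0 ≤ R) (hα : 0 < α) :
    tsupport (barrier x₀ R α) ⊆ closedBall x₀ R := by
  refine closure_minimal (fun z hz => ?_) isClosed_closedBall
  by_contra h
  refine hz (expNegInvGlue.zero_of_nonpos (div_nonpos_of_nonpos_of_nonneg ?_ hα.le))
  rw [mem_closedBall, dist_eq_norm, not_le] at h
  nlinarith

theorem lap_barrier (z : ℂ) : lap (barrier x₀ R α) z =
    (4 * ‖z - x₀‖ ^ 2 / α ^ 2 * ((((R ^ 2 - ‖z - x₀‖ ^ 2) / α)⁻¹ ^ 4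
      - 2 * ((R ^ 2 - ‖z - x₀‖ ^ 2) / α)⁻¹ ^ 3))
      - 4 / α * ((R ^ 2 - ‖z - x₀‖ ^ 2) / α)⁻¹ ^ 2) * barrier x₀ R α z := by
  set q : ℂ → ℝ := fun z => (R ^ 2 - ‖z - x₀‖ ^ 2) / α with hq
  have hqd : ∀ z, HasFDerivAt q (-(2 / α) • innerSL ℝ (z - x₀)) z := fun z => by
    have h1 : HasFDerivAt (fun z : ℂ => ‖z - x₀‖ ^ 2) _ z :=
      ((hasFDerivAt_id z).sub_const x₀).norm_sq
    have h2 := (h1.const_sub (R ^ 2)).mul_const α⁻¹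
    refine HasFDerivAt.congr_fderiv (f' := _) (by simpa only [hq, div_eq_mul_inv] using h2) ?_
    ext v
    simp
    ring
  have hd1 : ∀ z v, fderiv ℝ (barrier x₀ R α) z v =
      ((q z)⁻¹ ^ 2 * expNegInvGlue (q z)) * (-(2 / α) * inner ℝ (z - x₀) v) := fun z v => by
    have h := (hasDerivAt_expNegInvGlue (q z)).comp_hasFDerivAt z (hqd z)
    have h' : HasFDerivAt (barrier x₀ R α) _ z := h
    rw [h'.fderiv]
    simp only [smul_apply, smul_eq_mul, innerSL_apply_apply]
  have hd2 : ∀ v, fderiv ℝ (fun y => fderiv ℝ (barrier x₀ R α) y v) z v =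
      ((q z)⁻¹ ^ 4 - 2 * (q z)⁻¹ ^ 3) * expNegInvGlue (q z)
        * (-(2 / α) * inner ℝ (z - x₀) v) ^ 2
      + ((q z)⁻¹ ^ 2 * expNegInvGlue (q z)) * (-(2 / α) * inner ℝ v v) := fun v => by
    have h1 := (hasDerivAt_inv_sq_mul_expNegInvGlue (q z)).comp_hasFDerivAt z (hqd z)
    have h2 : HasFDerivAt (fun z : ℂ => -(2 / α) * inner ℝ (z - x₀) v)
        (-(2 / α) • innerSL ℝ v) z := by
      have h3 : HasFDerivAt (fun z : ℂ => inner ℝ (z - x₀) v) (innerSL ℝ v) z := by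
        have h4 := (innerSL ℝ v).hasFDerivAt.comp z ((hasFDerivAt_id z).sub_const x₀)
        have h5 : (fun z : ℂ => inner ℝ (z - x₀) v) = (innerSL ℝ v) ∘ fun z => id z - x₀ := by
          ext z
          simp [real_inner_comm]
        rw [h5]
        exact h4
      exact h3.const_mul _
    have h3 := h1.mul h2
    have h4 : (fun y => fderiv ℝ (barrier x₀ R α) y v)
        = ((fun x => x⁻¹ ^ 2 * expNegInvGlue x) ∘ q) * fun z => -(2 / α) * inner ℝ (z - x₀) v :=
      funext fun y => hd1 y v
    rw [h4, h3.fderiv]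
    simp only [add_apply, smul_apply, smul_eq_mul,
      innerSL_apply_apply, Function.comp_apply]
    ring
  have hsq : ‖z - x₀‖ ^ 2 = (z - x₀).re ^ 2 + (z - x₀).im ^ 2 := by
    rw [← Complex.normSq_eq_norm_sq, Complex.normSq_apply]; ring
  have hin1 : inner ℝ (z - x₀) 1 = (z - x₀).re := by simp [Complex.inner]
  have hinI : inner ℝ (z - x₀) Complex.I = (z - x₀).im := by
    simp [Complex.inner]; ring
  have h11 : inner ℝ (1 : ℂ) 1 = 1 := by simp
  have hII : inner ℝ Complex.I Complex.I = 1 := by simp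
  rw [lap, hd2, hd2, hin1, hinI, h11, hII]
  have hb : barrier x₀ R α z = expNegInvGlue (q z) := rfl
  rw [hb]
  change _ = (4 * ‖z - x₀‖ ^ 2 / α ^ 2 * ((q z)⁻¹ ^ 4 - 2 * (q z)⁻¹ ^ 3)
    - 4 / α * (q z)⁻¹ ^ 2) * expNegInvGlue (q z)
  rw [hsq]
  ring

/-- For large `α` the barrier is strictly subharmonic away from the centre. -/
theorem lap_barrier_pos {ρ : ℝ} (hρ : 0 < ρ) (hα : 4 * R ^ 2 + 4 * R ^ 4 / ρ ^ 2 < α) {z : ℂ}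
    (hz : ρ ≤ ‖z - x₀‖) (hz' : ‖z - x₀‖ < R) : 0 < lap (barrier x₀ R α) z := by
  have hR : 0 < R := hρ.trans_le (hz.trans hz'.le)
  have hα0 : 0 < α := lt_trans (by positivity) hα
  have hα1 : 4 * R ^ 2 < α := lt_of_le_of_lt (le_add_of_nonneg_right (by positivity)) hα
  have hα2 : 4 * R ^ 4 < α * ρ ^ 2 := by
    have h1 : 4 * R ^ 4 / ρ ^ 2 < α := lt_of_le_of_lt (le_add_of_nonneg_left (by positivity)) hα
    rwa [div_lt_iff₀ (by positivity)] at h1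
  set s := ‖z - x₀‖ with hs
  have hs2 : ρ ^ 2 ≤ s ^ 2 := pow_le_pow_left₀ hρ.le hz 2
  have hsR : s ^ 2 < R ^ 2 := pow_lt_pow_left₀ hz' (norm_nonneg _) (by simp)
  set q := (R ^ 2 - s ^ 2) / α with hq
  have hq0 : 0 < q := div_pos (sub_pos.2 hsR) hα0
  have hqα : q * α ≤ R ^ 2 := by
    rw [hq, div_mul_cancel₀ _ hα0.ne']
    linarith [sq_nonneg s]
  have hq4 : q ≤ 1 / 4 := by
    by_contra h
    have : 1 / 4 * α < q * α := mul_lt_mul_of_pos_right (not_le.1 h) hα0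
    linarith
  rw [lap_barrier, ← hs, ← hq]
  refine mul_pos ?_ (expNegInvGlue.pos_of_pos hq0)
  have e : 4 * s ^ 2 / α ^ 2 * (q⁻¹ ^ 4 - 2 * q⁻¹ ^ 3) - 4 / α * q⁻¹ ^ 2
      = 4 / α ^ 2 * q⁻¹ ^ 4 * (s ^ 2 * (1 - 2 * q) - α * q ^ 2) := by
    field_simp
  rw [e]
  refine mul_pos (by positivity) ?_
  have h1 : ρ ^ 2 * (1 / 2) ≤ s ^ 2 * (1 - 2 * q) :=
    mul_le_mul hs2 (by linarith) (by norm_num) (sq_nonneg _)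
  have h2 : α * (α * q ^ 2) ≤ R ^ 4 := by
    have : (q * α) ^ 2 ≤ (R ^ 2) ^ 2 := pow_le_pow_left₀ (by positivity) hqα 2
    nlinarith
  have h3 : α * q ^ 2 < ρ ^ 2 * (1 / 2) := by
    by_contra h
    have h4 := mul_le_mul_of_nonneg_left (not_lt.1 h) hα0.le
    have : 0 < R ^ 4 := by positivity
    linarith
  linarith

end barrier

/-- Propagation of a maximum from a disc to a larger concentric disc, by testing subharmonicity
against the barrier: `∫ (c - v) Δψ ≤ 0` although the integrand is nonnegative. -/
theorem IsWeaklySubharmonicOn.eqOn_ball {v : ℂ → ℝ} {D : Set ℂ} (hv : IsWeaklySubharmonicOn v D)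
    (hcont : ContinuousOn v D) {x₀ : ℂ} {ρ R c : ℝ} (hρ : 0 < ρ) (hD : closedBall x₀ R ⊆ D)
    (hle : ∀ z ∈ closedBall x₀ R, v z ≤ c) (heq : ∀ z ∈ ball x₀ ρ, v z = c) :
    ∀ z ∈ ball x₀ R, v z = c := by
  rcases lt_or_ge R 0 with hR | hR
  · intro z hz
    exact absurd (pos_of_mem_ball hz) (not_lt.2 hR.le)
  obtain ⟨α, hα⟩ := exists_gt (4 * R ^ 2 + 4 * R ^ 4 / ρ ^ 2)
  have hα0 : 0 < α := lt_of_le_of_lt (by positivity) hα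
  set ψ := barrier x₀ R α
  have hψ : ContDiff ℝ ∞ ψ := contDiff_barrier
  have hts : tsupport ψ ⊆ closedBall x₀ R := tsupport_barrier_subset hR hα0
  have hc : HasCompactSupport ψ :=
    (isCompact_closedBall x₀ R).of_isClosed_subset (isClosed_tsupport _) hts
  have hint : ∀ w : ℂ → ℝ, ContinuousOn w (closedBall x₀ R) →
      Integrable fun z => w z * lap ψ z := by
    intro w hw
    rw [← integrableOn_iff_integrable_of_support_subset (s := tsupport ψ)]
    · exact ((hw.mono hts).mul (continuous_lap hψ).continuousOn).integrableOn_compact hc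
    · intro z hz
      by_contra h
      exact hz (by simp [lap_of_notMem_tsupport h])
  have hvc := hcont.mono hD
  have h1 := hv ψ hψ hc (hts.trans hD) fun z => expNegInvGlue.nonneg _
  have h2 : ∫ z, (c - v z) * lap ψ z ≤ 0 := by
    simp only [sub_mul]
    rw [integral_sub (hint _ continuousOn_const) (hint _ hvc), integral_const_mul,
      integral_lap_eq_zero hψ hc]
    linarith
  have hclosed : ∀ z, ¬ z ∈ ball x₀ R → lap ψ z = 0 := by
    -- On the boundary circle `lap ψ` vanishes because the barrier does.
    intro z hz
    rw [lap_barrier]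
    have h3 : barrier x₀ R α z = 0 := by
      refine expNegInvGlue.zero_of_nonpos (div_nonpos_of_nonpos_of_nonneg ?_ hα0.le)
      rw [mem_ball, dist_eq_norm, not_lt] at hz
      nlinarith
    rw [h3, mul_zero]
  have hnn : ∀ z, 0 ≤ (c - v z) * lap ψ z := by
    intro z
    by_cases hzR : z ∈ ball x₀ R
    · by_cases hzρ : z ∈ ball x₀ ρ
      · rw [heq z hzρ, sub_self, zero_mul]
      · refine mul_nonneg (sub_nonneg.2 (hle z (ball_subset_closedBall hzR))) ?_
        rw [mem_ball, dist_eq_norm] at hzR hzρ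
        exact (lap_barrier_pos hρ hα (not_lt.1 hzρ) hzR).le
    · rw [hclosed z hzR, mul_zero]
  have h3 : (fun z => (c - v z) * lap ψ z) =ᵐ[volume] 0 :=
    (integral_eq_zero_iff_of_nonneg hnn (hint _ (continuousOn_const.sub hvc))).1
      (le_antisymm h2 (integral_nonneg hnn))
  have h4 : v =ᵐ[volume.restrict (ball x₀ R)] fun _ => c := by
    rw [EventuallyEq, ae_restrict_iff' measurableSet_ball]
    filter_upwards [h3] with z hz hzR
    by_cases hzρ : z ∈ ball x₀ ρ
    · exact heq z hzρ
    · rw [mem_ball, dist_eq_norm] at hzR hzρ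
      have h5 := lap_barrier_pos hρ hα (not_lt.1 hzρ) hzR
      rcases mul_eq_zero.1 hz with h6 | h6
      · linarith
      · exact absurd h6 h5.ne'
  exact Measure.eqOn_open_of_ae_eq h4 isOpen_ball (hvc.mono ball_subset_closedBall)
    continuousOn_const

/-- The strong maximum principle: a weakly subharmonic function bounded by `c` on a connected open
set and equal to `c` near one of its points is constant on that set. -/
theorem IsWeaklySubharmonicOn.eqOn_of_isPreconnected {v : ℂ → ℝ} {D V : Set ℂ}
    (hv : IsWeaklySubharmonicOn v D) (hcont : ContinuousOn v D) (hVo : IsOpen V)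
    (hVc : IsPreconnected V) (hVD : V ⊆ D) {c : ℝ} (hle : ∀ z ∈ V, v z ≤ c) {x : ℂ} (hx : x ∈ V)
    (heq : ∀ᶠ z in 𝓝 x, v z = c) : ∀ z ∈ V, v z = c := by
  suffices h : V ⊆ interior {z | v z = c} from fun z hz =>
    interior_subset (s := {z | v z = c}) (h hz)
  refine hVc.subset_of_closure_inter_subset isOpen_interior
    ⟨x, hx, mem_interior_iff_mem_nhds.2 heq⟩ ?_
  rintro y ⟨hyc, hyV⟩
  obtain ⟨δ, hδ, hsub⟩ := Metric.isOpen_iff.1 hVo y hyV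
  obtain ⟨x₀, hx₀, hd⟩ := Metric.mem_closure_iff.1 hyc (δ / 4) (by positivity)
  obtain ⟨ρ, hρ, hρsub⟩ := Metric.isOpen_iff.1 isOpen_interior x₀ hx₀
  have hball : closedBall x₀ (δ / 2) ⊆ V := fun w hw => hsub <| by
    have h1 := dist_triangle w x₀ y
    rw [dist_comm x₀ y] at h1
    rw [mem_closedBall] at hw
    rw [mem_ball]
    linarith
  have h := hv.eqOn_ball hcont hρ (hball.trans hVD) (fun z hz => hle z (hball hz))
    (fun z hz => interior_subset (s := {z | v z = c}) (hρsub hz))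
  exact mem_interior_iff_mem_nhds.2 (Filter.mem_of_superset
    (isOpen_ball.mem_nhds (mem_ball.2 (hd.trans (by linarith)))) h)

/-! ### The potential in a sector -/


theorem convex_setOf_nonneg_smul {Q : Set ℂ} (hQ : Convex ℝ Q) :
    Convex ℝ {t : ℂ | ∃ s : ℝ, 0 ≤ s ∧ ∃ e ∈ Q, t = s • e} := by
  rintro _ ⟨s₁, hs₁, e₁, he₁, rfl⟩ _ ⟨s₂, hs₂, e₂, he₂, rfl⟩ a b ha hb hab
  have h₁ := mul_nonneg ha hs₁
  have h₂ := mul_nonneg hb hs₂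
  rcases (add_nonneg h₁ h₂).eq_or_lt with h | h
  · have h₁' : a * s₁ = 0 := by linarith
    have h₂' : b * s₂ = 0 := by linarith
    exact ⟨0, le_rfl, e₁, he₁, by simp [smul_smul, h₁', h₂', -Complex.real_smul]⟩
  · refine ⟨a * s₁ + b * s₂, h.le, (a * s₁ / (a * s₁ + b * s₂)) • e₁ +
      (b * s₂ / (a * s₁ + b * s₂)) • e₂, hQ he₁ he₂ (by positivity) (by positivity) ?_, ?_⟩
    · rw [← add_div, div_self h.ne']
    · rw [smul_add, smul_smul, smul_smul, smul_smul, smul_smul, mul_div_cancel₀ _ h.ne',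
        mul_div_cancel₀ _ h.ne']

section

variable {r : ℕ} {M : Fin r → Set ℂ} {A F : Fin r → ℂ → ℂ} {p : ℂ} {R : ℝ} {u : ℂ → ℝ}

open scoped Pointwise in
/-- In the chart `f` at `p`, let `Q` be a convex set of directions along which none of the
functions `Re (F k - F i)` increases. From a point of `M i` the function `u - Re (F i)` then does
not increase in the directions of the cone over `Q`, while it is constant near that point, so the
strong maximum principle makes it constant on the translated cone. Since `M i` accumulates at `p`,
the function `u` coincides with `Re (F i)` on the cone with vertex `p`. -/
theorem IsPotential.eventually_eq_re_of_cone (hu : IsPotential p R M A F u) (hR : 0 < R)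
    {i : Fin r} (hp : p ∈ closure (M i))
    (hFc : ContinuousOn (F i) (ball p R)) (hFp : F i p = 0)
    (hsub : IsWeaklySubharmonicOn (fun z => u z - (F i z).re) (ball p R))
    {f : ℂ → ℂ} (hf : AnalyticAt ℂ f p) (hfp : f p = 0) (hf' : deriv f p ≠ 0)
    {Q : Set ℂ} (hQ : Convex ℝ Q)
    (hmono : ∀ᶠ z in 𝓝 p, ∀ e ∈ Q, ∀ k, ((A k z - A i z) * (e / deriv f z)).re ≤ 0) :
    ∀ᶠ z in 𝓝 p, ∀ s : ℝ, 0 ≤ s → ∀ e ∈ Q, f z = s • e → u z = (F i z).re := by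
  set v : ℂ → ℝ := fun z => u z - (F i z).re with hv
  have hvc : ContinuousOn v (ball p R) := by
    obtain ⟨C, hC⟩ := hu.lipschitz
    exact hC.continuousOn.sub (Complex.continuous_re.comp_continuousOn hFc)
  have hvp : v p = 0 := by simp [hv, hu.map_center, hFp]
  have hstrict : HasStrictDerivAt f (deriv f p) p := hf.hasStrictDerivAt
  set E := (hstrict.hasStrictFDerivAt_equiv hf').toOpenPartialHomeomorph f with hE
  have hEf : ∀ z, E z = f z := fun z => rfl
  have hpE : p ∈ E.source :=
    (hstrict.hasStrictFDerivAt_equiv hf').mem_toOpenPartialHomeomorph_source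
  have hE0 : E.symm 0 = p := by rw [← hfp, ← hEf]; exact E.left_inv hpE
  have h0E : (0 : ℂ) ∈ E.target := by rw [← hfp, ← hEf]; exact E.map_source hpE
  have hinv : ContinuousAt (fun z => ‖(deriv f z)⁻¹‖) p :=
    (hf.deriv.continuousAt.inv₀ hf').norm
  obtain ⟨C, hC⟩ := exists_gt ‖(deriv f p)⁻¹‖
  have hgood : ∀ᶠ z in 𝓝 p, z ∈ ball p R ∧ HasDerivAt f (deriv f z) z ∧ deriv f z ≠ 0 ∧
      ‖(deriv f z)⁻¹‖ < C ∧ ∀ e ∈ Q, ∀ k, ((A k z - A i z) * (e / deriv f z)).re ≤ 0 := by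
    filter_upwards [ball_mem_nhds p hR, hf.eventually_analyticAt,
      hf.deriv.continuousAt.eventually_ne hf', hinv.eventually_lt_const hC, hmono]
      with z h1 h2 h3 h4 h5
    exact ⟨h1, h2.differentiableAt.hasDerivAt, h3, h4, h5⟩
  obtain ⟨ρ, hρ, hρsub⟩ : ∃ ρ > 0, ∀ w ∈ ball (0 : ℂ) ρ, w ∈ E.target ∧
      E.symm w ∈ ball p R ∧ HasDerivAt f (deriv f (E.symm w)) (E.symm w) ∧
      deriv f (E.symm w) ≠ 0 ∧ ‖(deriv f (E.symm w))⁻¹‖ < C ∧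
      ∀ e ∈ Q, ∀ k, ((A k (E.symm w) - A i (E.symm w)) * (e / deriv f (E.symm w))).re ≤ 0 := by
    have h1 : ContinuousAt E.symm 0 := E.continuousAt_symm h0E
    have h2 := E.open_target.eventually_mem h0E
    obtain ⟨ρ, hρ, h⟩ := Metric.eventually_nhds_iff_ball.1
      ((h1.eventually (by rwa [hE0])).and h2)
    exact ⟨ρ, hρ, fun w hw => ⟨(h w hw).2, (h w hw).1⟩⟩
  have hgd : ∀ w ∈ ball (0 : ℂ) ρ, HasDerivAt E.symm (deriv f (E.symm w))⁻¹ w := fun w hw =>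
    E.hasDerivAt_symm (hρsub w hw).1 (hρsub w hw).2.2.2.1 (hρsub w hw).2.2.1
  have hvg : ∀ w ∈ ball (0 : ℂ) ρ, ContinuousAt (fun w => v (E.symm w)) w := fun w hw =>
    ContinuousAt.comp (f := E.symm) (hvc.continuousAt (isOpen_ball.mem_nhds (hρsub w hw).2.1))
      (hgd w hw).continuousAt
  set T : Set ℂ := {t : ℂ | ∃ s : ℝ, 0 ≤ s ∧ ∃ e ∈ Q, t = s • e} with hT
  have hTconv : Convex ℝ T := convex_setOf_nonneg_smul hQ
  -- `v` does not increase along the directions of the cone.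
  have hanti : ∀ w ∈ ball (0 : ℂ) ρ, ∀ t ∈ T, w + t ∈ ball (0 : ℂ) ρ →
      v (E.symm (w + t)) ≤ v (E.symm w) := by
    rintro w hw _ ⟨s, hs, e, he, rfl⟩ hwt
    have hmem : ∀ τ ∈ Icc (0 : ℝ) 1, w + τ • (s • e) ∈ ball (0 : ℂ) ρ := fun τ hτ => by
      have := (convex_ball (0 : ℂ) ρ).add_smul_sub_mem hw hwt hτ
      rwa [add_sub_cancel_left] at this
    have h := hu.antitone i (fun τ => E.symm (w + τ • (s • e)))
      (fun τ => (deriv f (E.symm (w + τ • (s • e))))⁻¹ * (s • e)) (C * ‖s • e‖)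
      (fun τ hτ => (hρsub _ (hmem τ hτ)).2.1)
      (fun τ hτ => by
        have h1 := ((hasDerivAt_id τ).smul_const (s • e)).const_add w
        rw [one_smul] at h1
        exact ((hgd _ (hmem τ hτ)).hasFDerivAt.restrictScalars ℝ).comp_hasDerivAt τ h1
          |>.congr_deriv (by simp [mul_comm]))
      (fun τ hτ => by
        rw [norm_mul]
        exact mul_le_mul_of_nonneg_right (hρsub _ (hmem τ hτ)).2.2.2.2.1.le (norm_nonneg _))
      (fun τ hτ k => by
        have h1 := (hρsub _ (hmem τ hτ)).2.2.2.2.2 e he k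
        have h2 : ∀ a b : ℂ, a * (b⁻¹ * s • e) = (s : ℂ) * (a * (e / b)) := fun a b => by
          rw [Complex.real_smul]; ring
        rw [h2, Complex.re_ofReal_mul]
        exact mul_nonpos_of_nonneg_of_nonpos hs h1)
    have h' : v (E.symm (w + (1 : ℝ) • s • e)) ≤ v (E.symm (w + (0 : ℝ) • s • e)) := h
    rwa [one_smul, zero_smul, add_zero] at h'
  -- From a point of `M i` on, `v` is constant on the cone.
  have hconst : ∀ x ∈ M i, x ∈ E.source → f x ∈ ball (0 : ℂ) ρ → ∀ t ∈ T,
      f x + t ∈ ball (0 : ℂ) ρ → v (E.symm (f x + t)) = v x := by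
    intro x hxM hxE hx t ht hxt
    have hgx : E.symm (f x) = x := E.left_inv hxE
    have hxR : x ∈ ball p R := hgx ▸ (hρsub _ hx).2.1
    have hloc : ∀ᶠ z in 𝓝 x, v z = v x := hu.locally_eq i x ⟨hxM, hxR⟩
    obtain ⟨ε, hε, hεsub⟩ := Metric.eventually_nhds_iff_ball.1
      (((hgd _ hx).continuousAt.eventually (by rwa [hgx])).and (isOpen_ball.mem_nhds hx))
    set W : Set ℂ := (ball (f x) ε + T) ∩ ball (0 : ℂ) ρ with hW
    have hWo : IsOpen W := isOpen_ball.add_right.inter isOpen_ball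
    have hWc : IsPreconnected W :=
      (((convex_ball _ _).add hTconv).inter (convex_ball _ _)).isPreconnected
    have hWt : W ⊆ E.target := fun w hw => (hρsub w hw.2).1
    have himage := E.symm_image_eq_source_inter_preimage hWt
    have h0T : (0 : ℂ) ∈ T := by
      obtain ⟨s, -, e, he, -⟩ := ht
      exact ⟨0, le_rfl, e, he, by simp⟩
    have hxW : f x ∈ W := ⟨⟨f x, mem_ball_self hε, 0, h0T, add_zero _⟩, hx⟩
    have hres := hsub.eqOn_of_isPreconnected hvc (V := E.symm '' W) (c := v x) (x := x)
      (by rw [himage]; exact E.isOpen_inter_preimage hWo)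
      (hWc.image _ (E.continuousOn_symm.mono hWt))
      (by rintro _ ⟨w, hw, rfl⟩; exact (hρsub w hw.2).2.1)
      (by
        rintro _ ⟨_, ⟨⟨w, hw, τ, hτ, rfl⟩, hb⟩, rfl⟩
        have h1 := hεsub w hw
        exact (hanti w h1.2 τ hτ hb).trans h1.1.le)
      ⟨f x, hxW, hgx⟩ hloc
    exact hres _ ⟨f x + t, ⟨⟨f x, mem_ball_self hε, t, ht, rfl⟩, hxt⟩, rfl⟩
  have hfc : ContinuousAt f p := hf.continuousAt
  have hev : ∀ᶠ z in 𝓝 p, z ∈ E.source ∧ f z ∈ ball (0 : ℂ) ρ := by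
    refine (E.open_source.eventually_mem hpE).and (hfc.eventually ?_)
    rw [hfp]
    exact ball_mem_nhds _ hρ
  filter_upwards [hev] with z hz s hs e he hfz
  have htT : f z ∈ T := ⟨s, hs, e, he, hfz⟩
  have hgz : E.symm (f z) = z := E.left_inv hz.1
  have : (𝓝[M i] p).NeBot := mem_closure_iff_nhdsWithin_neBot.1 hp
  have hlim0 : Tendsto f (𝓝[M i] p) (𝓝 0) := by
    have := hfc.tendsto.mono_left (nhdsWithin_le_nhds (s := M i))
    rwa [hfp] at this
  have hlim1 : Tendsto (fun x => f x + f z) (𝓝[M i] p) (𝓝 (f z)) := by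
    simpa using hlim0.add_const (f z)
  have hlim2 : Tendsto (fun x => v (E.symm (f x + f z))) (𝓝[M i] p) (𝓝 (v z)) := by
    have := (hvg _ hz.2).tendsto.comp hlim1
    rwa [hgz] at this
  have hlim3 : Tendsto v (𝓝[M i] p) (𝓝 0) := by
    have := (hvc.continuousAt (ball_mem_nhds p hR)).tendsto.mono_left
      (nhdsWithin_le_nhds (s := M i))
    rwa [hvp] at this
  have heq : (fun x => v (E.symm (f x + f z))) =ᶠ[𝓝[M i] p] v := by
    filter_upwards [self_mem_nhdsWithin, nhdsWithin_le_nhds hev,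
      hlim1.eventually (isOpen_ball.mem_nhds hz.2)] with x h1 h2 h3
    exact hconst x h1 h2.1 h2.2 _ htT h3
  have := tendsto_nhds_unique (hlim2.congr' heq) hlim3
  simp only [hv] at this
  linarith

end

/-! ### Approach to a point along a direction -/

/-- The filter of punctured neighbourhoods of `p` in narrowing sectors around the direction
`d`. -/
noncomputable def sectorFilter (p d : ℂ) : Filter ℂ :=
  𝓝[≠] p ⊓ comap (fun z => ‖z - p‖⁻¹ • (z - p)) (𝓝 d)

theorem sectorFilter_le_nhdsNE (p d : ℂ) : sectorFilter p d ≤ 𝓝[≠] p := inf_le_left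

theorem sectorFilter_le_nhds (p d : ℂ) : sectorFilter p d ≤ 𝓝 p :=
  (sectorFilter_le_nhdsNE p d).trans nhdsWithin_le_nhds

/-- By compactness of the circle, a property that holds in a sector around each direction holds in
a punctured neighbourhood. -/
theorem eventually_nhdsNE_of_forall_sectorFilter {p : ℂ} {P : ℂ → Prop}
    (h : ∀ d ∈ sphere (0 : ℂ) 1, ∀ᶠ z in sectorFilter p d, P z) : ∀ᶠ z in 𝓝[≠] p, P z := by
  by_contra hcon
  set dir : ℂ → ℂ := fun z => ‖z - p‖⁻¹ • (z - p) with hdir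
  set G : Filter ℂ := 𝓝[≠] p ⊓ 𝓟 {z | ¬ P z} with hG
  have : G.NeBot := frequently_iff_neBot.1 (not_eventually.1 hcon)
  have hmap : map dir G ≤ 𝓟 (sphere 0 1) := by
    rw [le_principal_iff, mem_map]
    refine mem_inf_of_left ?_
    filter_upwards [self_mem_nhdsWithin] with z hz
    have h0 : ‖z - p‖ ≠ 0 := norm_ne_zero_iff.2 (sub_ne_zero.2 hz)
    rw [mem_preimage, mem_sphere_zero_iff_norm, hdir, norm_smul, norm_inv, norm_norm,
      inv_mul_cancel₀ h0]
  obtain ⟨d, hd, hcl⟩ := (isCompact_sphere (0 : ℂ) 1).exists_clusterPt hmap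
  have hne : (comap dir (𝓝 d) ⊓ G).NeBot := by
    rw [← map_neBot_iff dir, Filter.push_pull']
    exact hcl
  have hfreq : ∃ᶠ z in sectorFilter p d, ¬ P z := by
    rw [frequently_iff_neBot, sectorFilter, inf_assoc, inf_left_comm]
    exact hne
  exact hfreq (by simpa using h d hd)

theorem tendsto_smul_sectorFilter {f : ℂ → ℂ} {β p d : ℂ} (hf : HasDerivAt f β p)
    (hfp : f p = 0) : Tendsto (fun z => ‖z - p‖⁻¹ • f z) (sectorFilter p d) (𝓝 (β * d)) := by
  have h1 : Tendsto (slope f p) (sectorFilter p d) (𝓝 β) :=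
    (hasDerivAt_iff_tendsto_slope.1 hf).mono_left (sectorFilter_le_nhdsNE p d)
  have h2 : Tendsto (fun z => ‖z - p‖⁻¹ • (z - p)) (sectorFilter p d) (𝓝 d) :=
    tendsto_comap.mono_left inf_le_right
  refine (h1.mul h2).congr' ?_
  filter_upwards [sectorFilter_le_nhdsNE p d self_mem_nhdsWithin] with z hz
  have h0 : z - p ≠ 0 := sub_ne_zero.2 hz
  rw [slope_def_field, hfp, sub_zero, mul_smul_comm, div_mul_cancel₀ _ h0]

section

variable {U : Opens ℂ} {r : ℕ} {M : Fin r → Set ℂ} {A F : Fin r → ℂ → ℂ} {Φ : ℂ → ℂ} {p : ℂ}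
  {R : ℝ} {u : ℂ → ℝ}

/-- The cone lemma applied to a chart `f` and the part of a cone `K` close to the direction
`f' (p) d`. -/
theorem IsPotential.eventually_sectorFilter (hu : IsPotential p R M A F u) (hR : 0 < R)
    {i : Fin r} (hp : p ∈ closure (M i))
    (hFc : ContinuousOn (F i) (ball p R)) (hFp : F i p = 0)
    (hsub : IsWeaklySubharmonicOn (fun z => u z - (F i z).re) (ball p R))
    {f : ℂ → ℂ} (hf : AnalyticAt ℂ f p) (hfp : f p = 0) (hf' : deriv f p ≠ 0) {d : ℂ}
    {K : Set ℂ} (hK : Convex ℝ K)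
    (hmono : ∀ᶠ q : ℂ × ℂ in 𝓝 (p, deriv f p * d), q.2 ∈ K →
      ∀ k, ((A k q.1 - A i q.1) * (q.2 / deriv f q.1)).re ≤ 0) :
    ∀ᶠ z in sectorFilter p d, ‖z - p‖⁻¹ • f z ∈ K → u z = (F i z).re := by
  rw [nhds_prod_eq, eventually_prod_iff] at hmono
  obtain ⟨P, hP, S, hS, hPS⟩ := hmono
  obtain ⟨δ, hδ, hδS⟩ := Metric.eventually_nhds_iff_ball.1 hS
  have h := hu.eventually_eq_re_of_cone hR hp hFc hFp hsub hf hfp hf'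
    (Q := K ∩ ball (deriv f p * d) δ) (hK.inter (convex_ball _ _))
    (hP.mono fun z hz e he => hPS hz (hδS e he.2) he.1)
  filter_upwards [sectorFilter_le_nhds p d h, sectorFilter_le_nhdsNE p d self_mem_nhdsWithin,
    (tendsto_smul_sectorFilter hf.differentiableAt.hasDerivAt hfp).eventually
      (ball_mem_nhds _ hδ)] with z hz hne hball hK'
  refine hz ‖z - p‖ (norm_nonneg _) _ ⟨hK', hball⟩ ?_
  rw [smul_smul, mul_inv_cancel₀ (norm_ne_zero_iff.2 (sub_ne_zero.2 hne)), one_smul]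

/-- Near a direction `d` for which `Re (F i)` has the largest derivative at `p`, the potential
agrees with `Re (F i)` wherever the latter is the largest of the `Re (F k)`. At most one other
index `j` can have the same derivative in the direction `d`; then `F i - F j` is used as a chart,
in which the set where `Re (F j) ≤ Re (F i)` is a half-plane. -/
theorem IsPotential.eventually_sectorFilter_of_max (hu : IsPotential p R M A F u) (hR : 0 < R)
    (hRU : closedBall p R ⊆ U) (hΦ : IsPiecewiseAnalytic U M A Φ)
    (hpos : toDistribution U Φ ∈ Sigma U) (hF : ∀ i, ∀ z ∈ U, HasDerivAt (F i) (A i z) z)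
    (hFp : ∀ i, F i p = 0) (h_active : ∀ i, p ∈ closure (M i))
    (h_noncollinear : ∀ i j k, i ≠ j → j ≠ k → i ≠ k →
      ¬ ∃ t : ℝ, A i p - A k p = (t : ℂ) * (A j p - A k p))
    (h_distinct : ∀ i k, i ≠ k → A i p ≠ A k p) {d : ℂ} (hd : d ≠ 0) {i : Fin r}
    (hmax : ∀ k, ((A k p - A i p) * d).re ≤ 0) :
    ∀ᶠ z in sectorFilter p d, (∀ k, (F k z).re ≤ (F i z).re) → u z = (F i z).re := by
  have hpU : p ∈ U := hRU (mem_closedBall_self hR.le)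
  have hbU := ball_subset_closedBall.trans hRU
  have hFc : ContinuousOn (F i) (ball p R) := fun z hz =>
    (hF i z (hbU hz)).continuousAt.continuousWithinAt
  have hsub := hu.isWeaklySubharmonicOn hΦ hpos hF hRU i
  have hAc : ∀ k, ContinuousAt (A k) p := fun k => (hΦ.analytic k p hpU).continuousAt
  -- The condition of strict decrease is open.
  have hopen : ∀ f : ℂ → ℂ, AnalyticAt ℂ f p → deriv f p ≠ 0 → ∀ k,
      ((A k p - A i p) * d).re < 0 → ∀ᶠ q : ℂ × ℂ in 𝓝 (p, deriv f p * d),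
      ((A k q.1 - A i q.1) * (q.2 / deriv f q.1)).re ≤ 0 := by
    intro f hf hf' k hk
    have hfst : ContinuousAt Prod.fst ((p, deriv f p * d) : ℂ × ℂ) := continuousAt_fst
    have h1 : ∀ g : ℂ → ℂ, ContinuousAt g p →
        ContinuousAt (fun q : ℂ × ℂ => g q.1) (p, deriv f p * d) := fun g hg =>
      ContinuousAt.comp (f := Prod.fst) (x := (p, deriv f p * d)) hg hfst
    have h2 : ContinuousAt (fun q : ℂ × ℂ => ((A k q.1 - A i q.1) * (q.2 / deriv f q.1)).re)
        (p, deriv f p * d) :=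
      Complex.continuous_re.continuousAt.comp
        (((h1 _ (hAc k)).sub (h1 _ (hAc i))).mul
          (continuousAt_snd.div (h1 _ hf.deriv.continuousAt) hf'))
    have h3 : ((A k p - A i p) * (deriv f p * d / deriv f p)).re < 0 := by
      rwa [mul_div_cancel_left₀ _ hf']
    exact (h2.eventually_lt_const h3).mono fun q hq => hq.le
  by_cases huniq : ∀ k, k ≠ i → ((A k p - A i p) * d).re < 0
  · have hf : AnalyticAt ℂ (fun z => z - p) p := by fun_prop
    have hf' : deriv (fun z : ℂ => z - p) p ≠ 0 := by
      rw [deriv_sub_const, deriv_id'']; exact one_ne_zero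
    have hmono : ∀ᶠ q : ℂ × ℂ in 𝓝 (p, deriv (fun z : ℂ => z - p) p * d), q.2 ∈ (univ : Set ℂ) →
        ∀ k, ((A k q.1 - A i q.1) * (q.2 / deriv (fun z : ℂ => z - p) q.1)).re ≤ 0 := by
      have : ∀ k, ∀ᶠ q : ℂ × ℂ in 𝓝 (p, deriv (fun z : ℂ => z - p) p * d),
          ((A k q.1 - A i q.1) * (q.2 / deriv (fun z : ℂ => z - p) q.1)).re ≤ 0 := fun k => by
        by_cases hk : k = i
        · exact Eventually.of_forall fun q => by simp [hk]
        · exact hopen _ hf hf' k (huniq k hk)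
      exact (eventually_all.2 this).mono fun q hq _ => hq
    exact (hu.eventually_sectorFilter hR (h_active i) hFc (hFp i) hsub hf (sub_self p) hf'
      convex_univ hmono).mono fun z hz _ => hz (mem_univ _)
  · push Not at huniq
    obtain ⟨j, hji, hj0⟩ := huniq
    have hj : ((A j p - A i p) * d).re = 0 := le_antisymm (hmax j) hj0
    -- A third maximizer `k` would put `A i p`, `A j p` and `A k p` on a real line.
    have hothers : ∀ k, k ≠ i → k ≠ j → ((A k p - A i p) * d).re < 0 := by
      intro k hki hkj
      refine lt_of_le_of_ne (hmax k) fun hk => ?_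
      have hne : (A j p - A i p) * d ≠ 0 :=
        mul_ne_zero (sub_ne_zero.2 (h_distinct j i hji)) hd
      have him : ((A j p - A i p) * d).im ≠ 0 := fun h => hne (Complex.ext hj h)
      refine h_noncollinear k j i hkj hji hki
        ⟨((A k p - A i p) * d).im / ((A j p - A i p) * d).im, ?_⟩
      refine mul_right_cancel₀ hd ?_
      rw [mul_assoc]
      apply Complex.ext
      · rw [hk, Complex.re_ofReal_mul, hj, mul_zero]
      · rw [Complex.im_ofReal_mul, div_mul_cancel₀ _ him]
    have hfd : ∀ z ∈ U, HasDerivAt (fun z => F i z - F j z) (A i z - A j z) z := fun z hz =>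
      (hF i z hz).sub (hF j z hz)
    have hf : AnalyticAt ℂ (fun z => F i z - F j z) p :=
      DifferentiableOn.analyticAt (s := U)
        (fun z hz => (hfd z hz).differentiableAt.differentiableWithinAt)
        (U.isOpen.mem_nhds hpU)
    have hfp' : deriv (fun z => F i z - F j z) p = A i p - A j p := (hfd p hpU).deriv
    have hf' : deriv (fun z => F i z - F j z) p ≠ 0 := by
      rw [hfp']; exact sub_ne_zero.2 (h_distinct i j hji.symm)
    have hU : ∀ᶠ q : ℂ × ℂ in 𝓝 (p, deriv (fun z => F i z - F j z) p * d),
        q.1 ∈ U ∧ deriv (fun z => F i z - F j z) q.1 ≠ 0 := by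
      have h1 : ∀ᶠ z in 𝓝 p, z ∈ U ∧ deriv (fun z => F i z - F j z) z ≠ 0 :=
        (U.isOpen.eventually_mem hpU).and (hf.deriv.continuousAt.eventually_ne hf')
      have h2 : ContinuousAt Prod.fst (p, deriv (fun z => F i z - F j z) p * d) := continuousAt_fst
      exact h2.eventually h1
    have hmono : ∀ᶠ q : ℂ × ℂ in 𝓝 (p, deriv (fun z => F i z - F j z) p * d),
        q.2 ∈ {e : ℂ | 0 ≤ e.re} →
        ∀ k, ((A k q.1 - A i q.1) * (q.2 / deriv (fun z => F i z - F j z) q.1)).re ≤ 0 := by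
      have : ∀ k, ∀ᶠ q : ℂ × ℂ in 𝓝 (p, deriv (fun z => F i z - F j z) p * d),
          q.2 ∈ {e : ℂ | 0 ≤ e.re} →
          ((A k q.1 - A i q.1) * (q.2 / deriv (fun z => F i z - F j z) q.1)).re ≤ 0 := by
        intro k
        by_cases hk : k = i
        · exact Eventually.of_forall fun q _ => by simp [hk]
        by_cases hk' : k = j
        · filter_upwards [hU] with q hq hqe
          have h1 := hq.2
          rw [(hfd q.1 hq.1).deriv] at h1 ⊢
          have h2 : (A k q.1 - A i q.1) * (q.2 / (A i q.1 - A j q.1)) = -q.2 := by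
            rw [hk']
            field_simp
            ring
          rw [h2, Complex.neg_re]
          exact neg_nonpos.2 hqe
        · exact (hopen _ hf hf' k (hothers k hk hk')).mono fun q hq _ => hq
      exact (eventually_all.2 this).mono fun q hq he k => hq k he
    refine (hu.eventually_sectorFilter hR (h_active i) hFc (hFp i) hsub hf (by simp [hFp]) hf'
      (convex_halfSpace_ge ⟨Complex.add_re, fun c x => by simp⟩ 0) hmono).mono fun z hz hle => ?_
    refine hz ?_
    rw [mem_ofPred_eq, Complex.smul_re, smul_eq_mul, Complex.sub_re]
    exact mul_nonneg (inv_nonneg.2 (norm_nonneg _)) (sub_nonneg.2 (hle j))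

/-- Near `p`, the potential is the maximum of the harmonic functions `Re (F k)`. -/
theorem IsPotential.eventually_eq_max [Nonempty (Fin r)] (hu : IsPotential p R M A F u)
    (hR : 0 < R) (hRU : closedBall p R ⊆ U) (hΦ : IsPiecewiseAnalytic U M A Φ)
    (hpos : toDistribution U Φ ∈ Sigma U) (hF : ∀ i, ∀ z ∈ U, HasDerivAt (F i) (A i z) z)
    (hFp : ∀ i, F i p = 0) (h_active : ∀ i, p ∈ closure (M i))
    (h_noncollinear : ∀ i j k, i ≠ j → j ≠ k → i ≠ k →
      ¬ ∃ t : ℝ, A i p - A k p = (t : ℂ) * (A j p - A k p))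
    (h_distinct : ∀ i k, i ≠ k → A i p ≠ A k p) :
    ∀ᶠ z in 𝓝 p, u z = ⨆ i, (F i z).re := by
  have hpU : p ∈ U := hRU (mem_closedBall_self hR.le)
  have hsup : ∀ z i, (∀ k, (F k z).re ≤ (F i z).re) → ⨆ i, (F i z).re = (F i z).re :=
    fun z i h => le_antisymm (ciSup_le h)
      (le_ciSup (f := fun i => (F i z).re) (Set.finite_range _).bddAbove i)
  have hsector : ∀ᶠ z in 𝓝[≠] p, u z = ⨆ i, (F i z).re := by
    refine eventually_nhdsNE_of_forall_sectorFilter fun d hd => ?_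
    have hd0 : d ≠ 0 := ne_zero_of_mem_unit_sphere ⟨d, hd⟩
    obtain ⟨i₀, hi₀⟩ := Finite.exists_max fun i => (A i p * d).re
    have h1 : ∀ i, ∀ᶠ z in sectorFilter p d, (A i p * d).re = (A i₀ p * d).re →
        (∀ k, (F k z).re ≤ (F i z).re) → u z = (F i z).re := by
      intro i
      by_cases hi : (A i p * d).re = (A i₀ p * d).re
      · refine (hu.eventually_sectorFilter_of_max hR hRU hΦ hpos hF hFp h_active h_noncollinear
          h_distinct hd0 (i := i) fun k => ?_).mono fun z hz _ => hz
        rw [sub_mul, Complex.sub_re, hi]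
        exact sub_nonpos.2 (hi₀ k)
      · exact Eventually.of_forall fun z h => absurd h hi
    have h2 : ∀ i, ∀ᶠ z in sectorFilter p d, (A i p * d).re ≠ (A i₀ p * d).re →
        (F i z).re < (F i₀ z).re := by
      intro i
      by_cases hi : (A i p * d).re = (A i₀ p * d).re
      · exact Eventually.of_forall fun z h => absurd hi h
      · have hlt := lt_of_le_of_ne (hi₀ i) hi
        have ht := tendsto_smul_sectorFilter (d := d) ((hF i₀ p hpU).sub (hF i p hpU))
          (by simp [hFp])
        have ht' := (Complex.continuous_re.tendsto _).comp ht
        have hpos' : 0 < ((A i₀ p - A i p) * d).re := by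
          rw [sub_mul, Complex.sub_re]; exact sub_pos.2 hlt
        filter_upwards [ht'.eventually_const_lt hpos'] with z hz _
        simp only [Function.comp_apply, Complex.smul_re, smul_eq_mul, Pi.sub_apply,
          Complex.sub_re] at hz
        exact sub_pos.1 (pos_of_mul_pos_right hz (inv_nonneg.2 (norm_nonneg _)))
    filter_upwards [eventually_all.2 h1, eventually_all.2 h2] with z hz1 hz2
    obtain ⟨i, hi⟩ := Finite.exists_max fun i => (F i z).re
    have him : (A i p * d).re = (A i₀ p * d).re := by
      by_contra h
      exact absurd (hi i₀) (not_le.2 (hz2 i h))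
    rw [hz1 i him hi, hsup z i hi]
  rw [eventually_nhdsWithin_iff] at hsector
  filter_upwards [hsector] with z hz
  by_cases hzp : z = p
  · rw [hzp, hu.map_center]
    simp [hFp]
  · exact hz hzp

end

/-! ### The potential as a distribution -/

theorem dz_eq_of_hasFDerivAt {u : ℂ → ℝ} {B z : ℂ} (h : HasFDerivAt u (reForm B) z) :
    2 * dz u z = B := by
  rw [dz, h.fderiv]
  apply Complex.ext <;> simp

/-- If a Lipschitz function has almost everywhere the derivative `Re (Φ dz)`, then
`Φ = 2 ∂u/∂z` as distributions. -/
theorem toDistribution_eq_two_smul_distDz {u φ : ℂ → ℝ} {Φ : ℂ → ℂ} {p : ℂ} {ρ : ℝ} {C : ℝ≥0}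
    {N : Opens ℂ} (hN : (N : Set ℂ) = ball p ρ) (hΦ : LocallyIntegrableOn Φ N)
    (hu : LipschitzOnWith C u (ball p ρ))
    (hd : ∀ᵐ z, z ∈ ball p ρ → HasFDerivAt u (reForm (Φ z)) z) (hφ : ∀ z ∈ ball p ρ, φ z = u z) :
    toDistribution N Φ = (2 : ℂ) • distDz (toDistribution N fun z => (φ z : ℂ)) := by
  have hφint : LocallyIntegrableOn (fun z => (φ z : ℂ)) N := by
    refine ContinuousOn.locallyIntegrableOn ?_ N.isOpen.measurableSet
    rw [hN]
    exact (Complex.continuous_ofReal.comp_continuousOn hu.continuousOn).congr fun z hz => by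
      simp [hφ z hz]
  ext ψ
  have hs : tsupport ψ ⊆ ball p ρ := hN ▸ ψ.tsupport_subset
  have hv : ∀ v : ℂ, (∂_{v} (toDistribution N fun z => (φ z : ℂ))) ψ =
      ((∫ z, (Φ z * v).re * ψ z : ℝ) : ℂ) := fun v => by
    rw [toDistribution_lineDeriv_apply hφint]
    have h1 := integral_mul_fderiv_eq hu hd (ψ.contDiff.of_le (by simp)) ψ.hasCompactSupport hs v
    rw [← neg_eq_iff_eq_neg] at h1
    rw [← h1, Complex.ofReal_neg, ← integral_complex_ofReal]
    congr 1
    refine integral_congr_ae (Eventually.of_forall fun z => ?_)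
    by_cases hz : z ∈ tsupport ψ
    · simp only [hφ z (hs hz)]
      push_cast
      ring
    · have : fderiv ℝ ψ z = 0 := by
        by_contra h
        exact hz (support_fderiv_subset ℝ h)
      simp [this]
  have hint : Integrable fun z => (ψ z : ℂ) * Φ z := by
    rw [← integrableOn_iff_integrable_of_support_subset (s := tsupport ψ)
      fun z hz => subset_tsupport _ fun h => hz (by simp [h])]
    exact (hΦ.integrableOn_compact_subset ψ.tsupport_subset ψ.hasCompactSupport).continuousOn_mul
      (Complex.continuous_ofReal.comp ψ.continuous).continuousOn ψ.hasCompactSupport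
  have e : ((2 : ℂ) • distDz (toDistribution N fun z => (φ z : ℂ))) ψ =
      2 * ((1 / 2 : ℂ) * ((∂_{(1 : ℂ)} (toDistribution N fun z => (φ z : ℂ))) ψ
        - Complex.I * (∂_{Complex.I} (toDistribution N fun z => (φ z : ℂ))) ψ)) := rfl
  have hre : ∀ v : ℂ, ∫ z, (Φ z * v).re * ψ z = ((∫ z, (ψ z : ℂ) * Φ z) * v).re := fun v => by
    rw [← integral_mul_const, ← Complex.reCLM_apply,
      ← ContinuousLinearMap.integral_comp_comm _ (hint.mul_const v)]
    refine integral_congr_ae (Eventually.of_forall fun z => ?_)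
    simp only [Complex.reCLM_apply]
    rw [mul_assoc, Complex.re_ofReal_mul, mul_comm]
  rw [e, hv, hv, hre, hre, toDistribution_apply hΦ]
  apply Complex.ext <;> simp

end PiecewiseAnalytic

open PiecewiseAnalytic Metric Set Filter Topology in
theorem theorem1 (U : Opens ℂ) (hU : IsSimplyConnected (U : Set ℂ)) {r : ℕ}
    (M : Fin r → Set ℂ) (A : Fin r → ℂ → ℂ) (Φ : ℂ → ℂ)
    (hΦ : PiecewiseAnalytic.IsPiecewiseAnalytic U M A Φ)
    (hpos : PiecewiseAnalytic.toDistribution U Φ ∈ PiecewiseAnalytic.Sigma U)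
    (p : ℂ) (hp : p ∈ U)
    (h_active : ∀ i, p ∈ closure (M i))
    (h_noncollinear : ∀ i j k, i ≠ j → j ≠ k → i ≠ k →
      ¬ ∃ t : ℝ, A i p - A k p = (t : ℂ) * (A j p - A k p))
    (h_distinct : ∀ i k, i ≠ k → A i p ≠ A k p) :
    ∃ N : Opens ℂ, p ∈ N ∧ N ≤ U ∧
      PiecewiseAnalytic.toDistribution N Φ =
        (2 : ℂ) • PiecewiseAnalytic.distDz (PiecewiseAnalytic.toDistribution N
          (fun z => (PiecewiseAnalytic.maxPrimitive U p A z : ℂ))) ∧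
      ∀ᵐ z ∂volume.restrict (N : Set ℂ),
        DifferentiableAt ℝ (PiecewiseAnalytic.maxPrimitive U p A) z ∧
          Φ z = 2 * PiecewiseAnalytic.dz (PiecewiseAnalytic.maxPrimitive U p A) z := by
  -- `U` has positive measure, so there is at least one piece.
  have hr : Nonempty (Fin r) := by
    by_contra h
    have h0 : ∀ᵐ z, z ∉ (U : Set ℂ) := by
      filter_upwards [hΦ.ae_mem] with z hz hzU
      obtain ⟨k, -⟩ := hz hzU
      exact h ⟨k⟩
    exact (U.isOpen.measure_pos volume ⟨p, hp⟩).ne' (measure_eq_zero_iff_ae_notMem.2 h0)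
  have hprim : ∀ i, ∃ F : ℂ → ℂ, F p = 0 ∧ ∀ z ∈ U, HasDerivAt F (A i z) z := fun i => by
    obtain ⟨F, hF⟩ := exists_primitive U.isOpen hU (hΦ.analytic i).differentiableOn
    exact ⟨fun z => F z - F p, sub_self _, fun z hz => (hF z hz).sub_const _⟩
  choose F hFp hF using hprim
  obtain ⟨R', hR', hball⟩ := Metric.nhds_basis_closedBall.mem_iff.1 (U.isOpen.mem_nhds hp)
  have hR : 0 < R' / 2 := half_pos hR'
  obtain ⟨u, hu⟩ := exists_isPotential hΦ hpos hF hR (half_lt_self hR') hball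
  have hRU : closedBall p (R' / 2) ⊆ U :=
    (closedBall_subset_closedBall (half_le_self hR'.le)).trans hball
  have hmax := hu.eventually_eq_max hR hRU hΦ hpos hF hFp h_active h_noncollinear h_distinct
  obtain ⟨ρ, hρ, hsub⟩ := Metric.eventually_nhds_iff_ball.1
    (hmax.and (ball_mem_nhds p hR))
  have hρR : ball p ρ ⊆ ball p (R' / 2) := fun z hz => (hsub z hz).2
  have hρU : ball p ρ ⊆ U := hρR.trans (ball_subset_closedBall.trans hRU)
  have heq : ∀ z ∈ ball p ρ, maxPrimitive U p A z = u z := fun z hz => by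
    rw [(hsub z hz).1, maxPrimitive]
    exact iSup_congr fun i =>
      rePrimitive_eq (hΦ.analytic i).continuousOn (hF i) (hFp i) hρU hz
  have hd := hu.ae_hasFDerivAt hΦ hF (ball_subset_closedBall.trans hRU)
  obtain ⟨C, hC⟩ := hu.lipschitz
  refine ⟨⟨ball p ρ, isOpen_ball⟩, mem_ball_self hρ, hρU, ?_, ?_⟩
  · exact toDistribution_eq_two_smul_distDz rfl (hΦ.locallyIntegrableOn.mono_set hρU)
      (hC.mono hρR) (hd.mono fun z hz hzρ => hz (hρR hzρ)) heq
  · refine (ae_restrict_iff' measurableSet_ball).2 ?_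
    filter_upwards [hd] with z hz hzρ
    have h1 : HasFDerivAt (maxPrimitive U p A) (reForm (Φ z)) z :=
      (hz (hρR hzρ)).congr_of_eventuallyEq
        (Filter.mem_of_superset (isOpen_ball.mem_nhds hzρ) heq)
    exact ⟨h1.differentiableAt, (dz_eq_of_hasFDerivAt h1).symm⟩
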